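/- Let $k\ge 3$ be a fixed integer. For $j\ge 0$ let $f_j(\lambda)=e^{\lambda}-\sum_{i=0}^{j-1}\lambda^i/i!$, let $h_k(\mu)=\mu e^{\mu}/f_{k-1}(\mu)$ for $\mu>0$, let $c_k=\inf\{h_k(\mu):\mu>0\}$, let $\mu_{k,c_k}$ be the unique $\mu>0$ with $h_k(\mu)=c_k$, and put $c_k'=\mu_{k,c_k}f_{k-1}(\mu_{k,c_k})/f_k(\mu_{k,c_k})$. For positive integers $n,m$ with $2m\ge kn$, choose $a:[2m]\to[n]$ uniformly at random among the functions with $|a^{-1}(v)|\ge k$ for every $v\in[n]$, and let $G=G_{\mathrm{multi}}(k,n,m)$ be the multigraph on $[n]$ with $m$ edges, the $i$-th of which joins $a(i)$ and $a(m+i)$ for $i\in[m]$. Degrees in a multigraph count each loop twice, and the $k$-core $K(H)$ of a multigraph $H$ is its maximal (possibly empty) subgraph in which every vertex has degree at least $k$. Given $G$, choose an edge $e$ uniformly at random among the $m$ edges of $G$, and let $W=n-|V(K(G-e))|$ be the number of vertices lost on passing from $G$ to the $k$-core of $G-e$. Let $m=m(n)$ and $c=c(n)=2m/n$; all limits are as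 $n\to\infty$, and "a.a.s." means with probability tending to $1$. 1. For every real $\varepsilon>0$ there is a constant $\varepsilon'>0$ (depending only on $k$ and $\varepsilon$) such that, for every $m=m(n)$ with $k\le c\le c_k'-\varepsilon$ for all sufficiently large $n$: for every function $h(n)\to\infty$, a.a.s. $W\le h(n)$ or $W\ge\varepsilon' n$; moreover, $W\ge\varepsilon' n$ with probability bounded away from zero, that is, $\liminf_{n\to\infty}\mathbb P(W\ge\varepsilon' n)>0$. 2. There is a constant $\varepsilon'>0$ (depending only on $k$) such that, for every $m=m(n)$ with $c\ge k$ for all sufficiently large $n$ and $c\to k$, we have $W\ge\varepsilon' n$ a.a.s. -/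

import Mathlib

open Filter Topology MeasureTheory ProbabilityTheory

namespace CoreRobust

/-! ### The threshold constant `c'_k` -/

/-- `f_k(x) = e^x - ∑_{i < k} x^i / i!`. -/
noncomputable def f (k : ℕ) (x : ℝ) : ℝ :=
  Real.exp x - ∑ i ∈ Finset.range k, x ^ i / (Nat.factorial i : ℝ)

/-- `h_k(μ) = μ e^μ / f_{k-1}(μ)`. -/
noncomputable def hFun (k : ℕ) (μ : ℝ) : ℝ :=
  Real.exp μ * μ / f (k - 1) μ

/-- `c_k = inf {h_k(μ) : μ > 0}`. -/
noncomputable def cCore (k : ℕ) : ℝ :=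
  sInf (hFun k '' Set.Ioi 0)

/-- The largest positive root `μ` of `h_k(μ) = c_k`. For `k ≥ 3` the infimum `c_k` is attained at
exactly one point of `(0, ∞)`, so the set below is a singleton and this is that point. -/
noncomputable def muCore (k : ℕ) : ℝ :=
  sSup {μ : ℝ | 0 < μ ∧ hFun k μ = cCore k}

/-- `c'_k = μ f_{k-1}(μ) / f_k(μ)` at `μ = μ_{k, c_k}`. -/
noncomputable def cPrime (k : ℕ) : ℝ :=
  muCore k * f (k - 1) (muCore k) / f k (muCore k)

/-! ### Degrees and `k`-cores of multigraphs -/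

/-- The degree of a vertex of a multigraph; every loop counts twice. -/
noncomputable def degree {α β : Type*} (G : Graph α β) (v : α) : ℕ :=
  {e | G.Inc e v}.ncard + {e | G.IsLoopAt e v}.ncard

/-- Every vertex of the multigraph `G` has degree at least `k`. -/
def MinDegreeGE {α β : Type*} (k : ℕ) (G : Graph α β) : Prop :=
  ∀ v ∈ G.vertexSet, k ≤ degree G v

/-- The `k`-core of `G`: its maximal subgraph of minimum degree at least `k` (possibly empty),
realised as the subgraph induced by the union of the vertex sets of all subgraphs of minimum degree
at least `k`. See `isGreatest_kCore`. -/
def kCore {α β : Type*} (k : ℕ) (G : Graph α β) : Graph α β :=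
  G.induce {v | ∃ H : Graph α β, H ≤ G ∧ MinDegreeGE k H ∧ v ∈ H.vertexSet}

theorem degree_mono {α β : Type*} [Finite β] {H G : Graph α β} (h : H ≤ G) (v : α) :
    degree H v ≤ degree G v :=
  add_le_add (Set.ncard_le_ncard (fun _ he => he.mono h) (Set.toFinite _))
    (Set.ncard_le_ncard (fun _ he => he.mono h) (Set.toFinite _))

theorem le_kCore {α β : Type*} {k : ℕ} {H G : Graph α β} (h : H ≤ G) (hH : MinDegreeGE k H) :
    H ≤ kCore k G :=
  ⟨fun _ hv => ⟨H, h, hH, hv⟩, fun _ _ _ he =>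
    ⟨he.mono h, ⟨H, h, hH, he.left_mem⟩, ⟨H, h, hH, he.right_mem⟩⟩⟩

/-- `kCore k G` is the largest subgraph of `G` of minimum degree at least `k`. -/
theorem isGreatest_kCore {α β : Type*} [Finite β] (k : ℕ) (G : Graph α β) :
    IsGreatest {H : Graph α β | H ≤ G ∧ MinDegreeGE k H} (kCore k G) := by
  refine ⟨⟨Graph.induce_le ?_, ?_⟩, fun H hH => le_kCore hH.1 hH.2⟩
  · rintro v ⟨H, hHG, -, hv⟩
    exact hHG.vertexSet_mono hv
  · rintro v ⟨H, hHG, hH, hv⟩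
    exact (hH v hv).trans (degree_mono (le_kCore hHG hH) v)

/-- The number of vertices that are lost on passing from `G` to the `k`-core of `G - e`. -/
noncomputable def lostVertices {α β : Type*} (k : ℕ) (G : Graph α β) (e : β) : ℕ :=
  G.vertexSet.ncard - (kCore k (G.deleteEdges {e})).vertexSet.ncard

/-! ### The allocation model restricted to `k`-cores -/

/-- The functions `a : [2m] → [n]` such that every fibre has at least `k` elements. -/
def allocations (k n m : ℕ) : Set (Fin (2 * m) → Fin n) :=
  {a | ∀ v : Fin n, k ≤ (a ⁻¹' {v}).ncard}

/-- The multigraph on `[n]` whose `i`-th edge joins `a(i)` and `a(m + i)`, for `i ∈ [m]`. -/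
def allocGraph {n m : ℕ} (a : Fin (2 * m) → Fin n) : Graph (Fin n) (Fin m) where
  vertexSet := Set.univ
  IsLink i x y :=
    (x = a ⟨i, by omega⟩ ∧ y = a ⟨m + i, by omega⟩) ∨
      (y = a ⟨i, by omega⟩ ∧ x = a ⟨m + i, by omega⟩)
  isLink_symm := fun _ _ => ⟨fun _ _ h => h.symm⟩
  eq_or_eq_of_isLink_of_isLink := by
    rintro i x y v w (⟨rfl, rfl⟩ | ⟨rfl, rfl⟩) (⟨rfl, rfl⟩ | ⟨rfl, rfl⟩) <;> simp
  left_mem_of_isLink := fun _ _ _ _ => Set.mem_univ _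

/-- The joint law of the random allocation and of the random edge: the allocation is uniform on
`allocations k n m` and, given it, the edge is uniform among the `m` edges of the multigraph.
Since every multigraph has exactly `m` edges, this is the uniform law on the pairs. -/
noncomputable def law (k n m : ℕ) : Measure ((Fin (2 * m) → Fin n) × Fin m) :=
  uniformOn (allocations k n m ×ˢ (Set.univ : Set (Fin m)))

/-- The random variable `W` of the multigraph model. -/
noncomputable def W (k : ℕ) {n m : ℕ} (ω : (Fin (2 * m) → Fin n) × Fin m) : ℕ :=
  lostVertices k (allocGraph ω.1) ω.2

/-- The average degree `c = 2m/n`. -/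
noncomputable def avgDegree (n m : ℕ) : ℝ := 2 * (m : ℝ) / (n : ℝ)

end CoreRobust

/-! Fix an allocation `a` of half-edges (points) to vertices and let `σ` be a uniform permutation.
The law of the allocation is invariant under permutations of the points, so it is enough to study
the multigraphs of `a ∘ σ`, that is, a uniformly random pairing of the points of a fixed `a`.

The core of `G - e` is found by a deletion process that exposes one partner per step. The partner of
an active point is uniform on the other remaining points. If it is light (at a vertex of degree
`k`), that vertex dies and `k - 1` points become active; otherwise it is merely removed. The number
of active points thus behaves like a branching process, supercritical when the proportion of light
points exceeds `1 / (k - 1)`. In that case there are `z, r < 1` such that `z ^ |A|` shrinks on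
average by the factor `r` in each of the first `κ n` steps, so surviving `j` steps and then dying
within `κ n` has probability at most `r ^ j` (`card_filter_dies_le`, `card_filter_stateAt_le`). The
lifetime of the process and `W` agree up to constants (`le_mul_W`, `W_le`), which excludes
intermediate values of `W`; with `j = 0` the same estimate gives a positive probability of `W` being
linear.

It remains to count light points. Moving a point from a vertex of load greater than `k` to another
vertex gives approximate balance equations between the numbers of vertices of loads `j` and `j + 1`,
which concentrate by a second moment bound (`sum_sq_defect_le`). They force the number of vertices
of load `k` to be at least about the truncated Poisson value (`balance_of_defect_le`). For that
distribution the proportion of light points equals `1 / (k - 1)` exactly at the minimiser of `h_k`,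
where the mean is `c'_k`, and monotonicity makes it larger below `c'_k` (`exists_supercritical`).

When `c → k` almost all points are light, so early extinction also becomes unlikely: a second choice
of weights, with `z` close to `0`, controls the first `j` steps (`W_near_k`). -/

namespace CoreRobust

/-! ### The deletion process and its deterministic properties -/

section Exploration

variable {H V : Type*} [DecidableEq H] [DecidableEq V]

/-- In a state `(A, L)` of the deletion process `A` is the set of active half-edges (they belong to
deleted vertices and their partners are still to be removed) and `L` the set of half-edges of the
surviving vertices. `hit a k s y` removes the half-edge `y`, and the vertex `a y` with it if its
degree drops below `k`. -/
def hit (a : H → V) (k : ℕ) (s : Finset H × Finset H) (y : H) : Finset H × Finset H :=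
  if y ∈ s.2 then
    if (s.2.filter (a · = a y)).card ≤ k then
      (s.1 ∪ (s.2.filter (a · = a y)).erase y, s.2.filter (a · ≠ a y))
    else (s.1, s.2.erase y)
  else (s.1.erase y, s.2)

/-- One step of the deletion process for the pairing `τ`: the partner of an active half-edge is
removed. -/
noncomputable def step (a : H → V) (k : ℕ) (τ : H → H) (s : Finset H × Finset H) :
    Finset H × Finset H :=
  if h : s.1.Nonempty then hit a k (s.1.erase h.choose, s.2) (τ h.choose) else s

/-- The half-edges in `L` at vertices of degree at most `k`. -/
def light (a : H → V) (k : ℕ) (L : Finset H) : Finset H :=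
  L.filter fun y => (L.filter (a · = a y)).card ≤ k

/-- The invariants of a state of the deletion process with set `U` of remaining half-edges. -/
structure Valid (a : H → V) (k : ℕ) (U : Finset H) (s : Finset H × Finset H) : Prop where
  disj : Disjoint s.1 s.2
  union : s.1 ∪ s.2 = U
  fibre : ∀ y ∈ s.2, k ≤ (s.2.filter (a · = a y)).card

variable {a : H → V} {k : ℕ} {τ : H → H} {U : Finset H} {s : Finset H × Finset H}

theorem Valid.erase (hs : Valid a k U s) (x : H) (hx : x ∈ s.1) :
    Valid a k (U.erase x) (s.1.erase x, s.2) := by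
  obtain ⟨h1, h2, h3⟩ := hs
  refine ⟨h1.mono_left (Finset.erase_subset _ _), ?_, h3⟩
  ext z
  have := Finset.disjoint_left.1 h1 hx
  simp only [← h2, Finset.mem_union, Finset.mem_erase]
  grind

theorem Valid.hit (hs : Valid a k U s) (y : H) : Valid a k (U.erase y) (hit a k s y) := by
  obtain ⟨h1, h2, h3⟩ := hs
  rw [Finset.disjoint_left] at h1
  unfold CoreRobust.hit
  split_ifs with hy hd
  · refine ⟨?_, ?_, ?_⟩
    · rw [Finset.disjoint_left]
      intro z
      simp only [Finset.mem_union, Finset.mem_erase, Finset.mem_filter]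
      grind
    · ext z
      simp only [← h2, Finset.mem_union, Finset.mem_erase, Finset.mem_filter]
      grind
    · intro z hz
      simp only [Finset.mem_filter] at hz
      refine (h3 z hz.1).trans (Finset.card_le_card fun w hw => ?_)
      simp only [Finset.mem_filter] at hw ⊢
      grind
  · refine ⟨?_, ?_, ?_⟩
    · rw [Finset.disjoint_left]
      intro z
      simp only [Finset.mem_erase]
      grind
    · ext z
      simp only [← h2, Finset.mem_union, Finset.mem_erase]
      grind
    · intro z hz
      simp only [Finset.mem_erase] at hz
      by_cases hzy : a z = a y
      · have : (s.2.erase y).filter (a · = a z) = (s.2.filter (a · = a y)).erase y := by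
          ext w; simp only [Finset.mem_filter, Finset.mem_erase]; grind
        rw [this, Finset.card_erase_of_mem (by simp [hy])]
        omega
      · refine (h3 z hz.2).trans (Finset.card_le_card fun w hw => ?_)
        simp only [Finset.mem_filter, Finset.mem_erase] at hw ⊢
        grind
  · refine ⟨?_, ?_, h3⟩
    · rw [Finset.disjoint_left]
      intro z
      simp only [Finset.mem_erase]
      grind
    · ext z
      simp only [← h2, Finset.mem_union, Finset.mem_erase]
      grind

theorem hit_of_mem_active (hs : Valid a k U s) {y : H} (hy : y ∈ s.1) :
    hit a k s y = (s.1.erase y, s.2) := by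
  simp [hit, Finset.disjoint_left.1 hs.disj hy]

/-- The invariant `fibre` forces a light fibre to have exactly `k` points, so `k - 1` of them become
active. This is the offspring number of the branching process. -/
theorem card_hit_of_mem_light (hs : Valid a k U s) {y : H} (hy : y ∈ light a k s.2) :
    (hit a k s y).1.card + 1 = s.1.card + k := by
  simp only [light, Finset.mem_filter] at hy
  have hyf : y ∈ s.2.filter (a · = a y) := by simp [hy.1]
  have hk : (s.2.filter (a · = a y)).card = k := le_antisymm hy.2 (hs.fibre y hy.1)
  have hpos := Finset.card_pos.2 ⟨y, hyf⟩
  simp only [hit, hy.1, hy.2, if_true]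
  rw [Finset.card_union_of_disjoint, Finset.card_erase_of_mem hyf]
  · omega
  · exact hs.disj.mono_right ((Finset.erase_subset _ _).trans (Finset.filter_subset _ _))

theorem hit_of_not_mem_light {y : H} (hy : y ∈ s.2) (hy' : y ∉ light a k s.2) :
    hit a k s y = (s.1, s.2.erase y) := by
  simp only [light, Finset.mem_filter, not_and] at hy'
  simp [hit, hy, hy' hy]

/-- Light points disappear only when a whole light fibre, of at most `k` points, is deleted;
removing a point from a heavier fibre can only create light points. -/
theorem card_light_le_hit (y : H) :
    (light a k s.2).card ≤ (light a k (hit a k s y).2).card + k := by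
  unfold hit
  split_ifs with hy hd
  · have : light a k s.2 ⊆ light a k (s.2.filter (a · ≠ a y)) ∪ s.2.filter (a · = a y) := by
      intro z hz
      simp only [light, Finset.mem_filter, Finset.mem_union] at hz ⊢
      by_cases hzy : a z = a y
      · right; exact ⟨hz.1, hzy⟩
      · left
        exact ⟨⟨hz.1, hzy⟩, (Finset.card_le_card
          (Finset.filter_subset_filter _ (Finset.filter_subset _ _))).trans hz.2⟩
    exact (Finset.card_le_card this).trans ((Finset.card_union_le _ _).trans (by simpa using hd))
  · refine le_add_right (Finset.card_le_card fun z hz => ?_)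
    simp only [light, Finset.mem_filter, Finset.mem_erase] at hz ⊢
    refine ⟨⟨?_, hz.1⟩, (Finset.card_le_card
      (Finset.filter_subset_filter _ (Finset.erase_subset _ _))).trans hz.2⟩
    rintro rfl
    exact hd hz.2
  · exact Nat.le_add_right _ _

theorem card_image_le_hit (y : H) :
    (s.2.image a).card ≤ ((hit a k s y).2.image a).card + 1 := by
  have : ∀ L : Finset H, (∀ z ∈ s.2, a z ≠ a y → z ∈ L) →
      (s.2.image a).card ≤ (L.image a).card + 1 := by
    intro L hL
    have h : s.2.image a ⊆ insert (a y) (L.image a) := by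
      intro v hv
      obtain ⟨z, hz, rfl⟩ := Finset.mem_image.1 hv
      by_cases h : a z = a y
      · simp [h]
      · exact Finset.mem_insert_of_mem (Finset.mem_image_of_mem _ (hL z hz h))
    exact (Finset.card_le_card h).trans (Finset.card_insert_le _ _)
  apply this
  intro z hz hne
  unfold hit
  split_ifs
  · simp [hz, hne]
  · simp only [Finset.mem_erase]; exact ⟨fun h => hne (by rw [h]), hz⟩
  · exact hz

/-- A potential argument: each lost vertex pays for the at most `k - 1` points that it activates. -/
theorem card_active_hit (y : H) :
    (hit a k s y).1.card + (k - 1) * ((hit a k s y).2.image a).card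
      ≤ s.1.card + (k - 1) * (s.2.image a).card := by
  unfold hit
  split_ifs with hy hd
  · have hyf : y ∈ s.2.filter (a · = a y) := by simp [hy]
    have h1 : (s.1 ∪ (s.2.filter (a · = a y)).erase y).card ≤ s.1.card + (k - 1) := by
      refine (Finset.card_union_le _ _).trans ?_
      rw [Finset.card_erase_of_mem hyf]
      omega
    have h2 : ((s.2.filter (a · ≠ a y)).image a).card + 1 ≤ (s.2.image a).card := by
      refine Nat.succ_le_of_lt (Finset.card_lt_card ⟨Finset.image_subset_image
        (Finset.filter_subset _ _), fun h => ?_⟩)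
      obtain ⟨z, hz, hzy⟩ := Finset.mem_image.1 (h (Finset.mem_image_of_mem a hy))
      exact (Finset.mem_filter.1 hz).2 hzy
    dsimp only
    nlinarith [Nat.mul_le_mul_left (k - 1) h2]
  · dsimp only
    gcongr
    exact Finset.erase_subset _ _
  · dsimp only
    gcongr
    exact Finset.erase_subset _ _

/-- A vertex meeting `C` has `k` points in `C` besides `y ∉ C`, so its degree exceeds `k` and it
survives the loss of `y`. -/
theorem subset_hit {C : Finset H} (hC : ∀ h ∈ C, k ≤ (C.filter (a · = a h)).card)
    (hCs : C ⊆ s.2) {y : H} (hy : y ∉ C) : C ⊆ (hit a k s y).2 := by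
  unfold hit
  split_ifs with hys hd
  · intro z hz
    simp only [Finset.mem_filter]
    refine ⟨hCs hz, fun hzy => ?_⟩
    have h1 := hC z hz
    have h2 : C.filter (a · = a z) ⊆ (s.2.filter (a · = a y)).erase y := by
      intro w hw
      simp only [Finset.mem_filter, Finset.mem_erase] at hw ⊢
      exact ⟨fun h => hy (h ▸ hw.1), hCs hw.1, hw.2.trans hzy⟩
    have h3 := Finset.card_le_card h2
    have hyf : y ∈ s.2.filter (a · = a y) := by simp [hys]
    have hpos := Finset.card_pos.2 ⟨y, hyf⟩
    rw [Finset.card_erase_of_mem hyf] at h3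
    omega
  · exact fun z hz => Finset.mem_erase.2 ⟨fun h => hy (h ▸ hz), hCs hz⟩
  · exact hCs

theorem step_of_empty (h : s.1 = ∅) : step a k τ s = s := by simp [step, h]

theorem iterate_step_of_empty (h : s.1 = ∅) (t : ℕ) : (step a k τ)^[t] s = s :=
  Function.iterate_fixed (step_of_empty h) t

/-- The active point `x` depends on the state alone and not on `τ`. Hence the partner of `x` can be
exposed as a fresh uniform choice. -/
theorem exists_step_eq_hit (a : H → V) (k : ℕ) (h : s.1.Nonempty) :
    ∃ x ∈ s.1, ∀ τ : H → H, step a k τ s = hit a k (s.1.erase x, s.2) (τ x) :=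
  ⟨h.choose, h.choose_spec, fun τ => by simp [step, h]⟩

theorem iterate_step_empty_of_le {i j : ℕ} (hij : i ≤ j) (h : ((step a k τ)^[i] s).1 = ∅) :
    (step a k τ)^[j] s = (step a k τ)^[i] s := by
  obtain ⟨l, rfl⟩ := Nat.exists_eq_add_of_le hij
  rw [add_comm, Function.iterate_add_apply, iterate_step_of_empty h]

/-- While the process is alive, each step uses up an active half-edge. -/
theorem card_active_iterate_step : ∀ (t : ℕ) (s : Finset H × Finset H),
    (∀ i < t, ((step a k τ)^[i] s).1 ≠ ∅) →
    t + (k - 1) * (((step a k τ)^[t] s).2.image a).card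
      ≤ s.1.card + (k - 1) * (s.2.image a).card := by
  intro t
  induction t with
  | zero => intro s _; simp
  | succ t ih =>
    intro s h
    have h0 : s.1.Nonempty := Finset.nonempty_iff_ne_empty.2 (h 0 (by omega))
    obtain ⟨x, hx, hst⟩ := exists_step_eq_hit a k h0
    have h1 := ih (step a k τ s) fun i hi => by
      rw [← Function.iterate_succ_apply]; exact h (i + 1) (by omega)
    rw [Function.iterate_succ_apply]
    have h2 := card_active_hit (a := a) (k := k) (s := (s.1.erase x, s.2)) (τ x)
    rw [← hst τ] at h2
    have := Finset.card_erase_add_one hx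
    dsimp only at h2
    omega

theorem card_image_le_iterate_step : ∀ (t : ℕ) (s : Finset H × Finset H),
    (s.2.image a).card ≤ (((step a k τ)^[t] s).2.image a).card + t := by
  intro t
  induction t with
  | zero => intro s; simp
  | succ t ih =>
    intro s
    rw [Function.iterate_succ_apply]
    have h1 := ih (step a k τ s)
    rcases s.1.eq_empty_or_nonempty with h0 | h0
    · rw [step_of_empty h0] at h1 ⊢; omega
    · obtain ⟨x, hx, hst⟩ := exists_step_eq_hit a k h0
      have h2 := card_image_le_hit (a := a) (k := k) (s := (s.1.erase x, s.2)) (τ x)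
      rw [← hst τ] at h2
      dsimp only at h2
      omega

/-- Active points lie outside `C` and `C` is closed under `τ`, so the process never hits `C`.
Applied to the points of the core, it shows that the core survives at all times. -/
theorem subset_iterate_step {C : Finset H} (hC : ∀ h ∈ C, k ≤ (C.filter (a · = a h)).card)
    (hτ : Function.Involutive τ) (hCτ : ∀ h ∈ C, τ h ∈ C) : ∀ (t : ℕ) (s : Finset H × Finset H),
    Disjoint s.1 C → C ⊆ s.2 → Valid a k (s.1 ∪ s.2) s → C ⊆ ((step a k τ)^[t] s).2 := by
  intro t
  induction t with
  | zero => intro s _ h _; simpa using h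
  | succ t ih =>
    intro s hd h hv
    rw [Function.iterate_succ_apply]
    rcases s.1.eq_empty_or_nonempty with h0 | h0
    · rw [step_of_empty h0]; exact ih s hd h hv
    · obtain ⟨x, hx, hst⟩ := exists_step_eq_hit a k h0
      have hv' := (hv.erase x hx).hit (τ x)
      have hxC : τ x ∉ C := fun hc => Finset.disjoint_left.1 hd hx (by simpa [hτ x] using hCτ _ hc)
      have hsub := subset_hit (s := (s.1.erase x, s.2)) hC h hxC
      rw [← hst τ] at hsub hv'
      exact ih _ (hv'.disj.mono_right hsub) hsub (by rw [hv'.union]; exact hv')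

/-- Points are removed in pairs, so the remaining set stays closed under `τ`. Once no point is
active, the survivors therefore form a genuine subgraph of minimum degree at least `k`. -/
theorem valid_iterate_step (hτ : Function.Involutive τ) : ∀ (t : ℕ) (s : Finset H × Finset H)
    (U : Finset H), Valid a k U s → (∀ h ∈ U, τ h ∈ U) →
    ∃ U' ⊆ U, Valid a k U' ((step a k τ)^[t] s) ∧ ∀ h ∈ U', τ h ∈ U' := by
  intro t
  induction t with
  | zero => intro s U hv hU; exact ⟨U, subset_rfl, hv, hU⟩
  | succ t ih =>
    intro s U hv hU
    rw [Function.iterate_succ_apply]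
    rcases s.1.eq_empty_or_nonempty with h0 | h0
    · rw [step_of_empty h0]; exact ih s U hv hU
    · obtain ⟨x, hx, hst⟩ := exists_step_eq_hit a k h0
      have hv' := (hv.erase x hx).hit (τ x)
      rw [← hst τ] at hv'
      obtain ⟨U', h1, h2, h3⟩ := ih _ _ hv' (by
        intro h hh
        simp only [Finset.mem_erase] at hh ⊢
        refine ⟨fun e => hh.2.1 (hτ.injective e), fun e => hh.1 ?_, hU h hh.2.2⟩
        rw [← e, hτ h])
      exact ⟨U', h1.trans ((Finset.erase_subset _ _).trans (Finset.erase_subset _ _)), h2, h3⟩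

end Exploration

/-! ### Random pairings and the supermartingale estimate -/

section Counting

variable {H V : Type*}

/-- The conjugate of the pairing `τ₀` by the permutation `σ`. -/
def conjPairing (τ₀ : H → H) (σ : Equiv.Perm H) (h : H) : H := σ (τ₀ (σ.symm h))

theorem conjPairing_involutive {τ₀ : H → H} (h₀ : Function.Involutive τ₀) (σ : Equiv.Perm H) :
    Function.Involutive (conjPairing τ₀ σ) := fun h => by simp [conjPairing, h₀ _]

theorem conjPairing_ne {τ₀ : H → H} (h₀ : ∀ h, τ₀ h ≠ h) (σ : Equiv.Perm H) (h : H) :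
    conjPairing τ₀ σ h ≠ h := by
  intro e
  apply h₀ (σ.symm h)
  rw [Equiv.eq_symm_apply]
  exact e

variable [DecidableEq H] [DecidableEq V]

theorem conjPairing_swap_mul {τ₀ : H → H} (σ : Equiv.Perm H) (u v x : H) :
    conjPairing τ₀ (Equiv.swap u v * σ) x
      = Equiv.swap u v (conjPairing τ₀ σ (Equiv.swap u v x)) := by
  simp [conjPairing, Equiv.Perm.mul_def]

/-- If `Q` is invariant under the transpositions of `U` and the pairings in `Q` preserve `U`, then
the partner of `x` is uniform on `U \ {x}`. -/
theorem card_filter_conjPairing {τ₀ : H → H} (h₀ : ∀ h, τ₀ h ≠ h) {U : Finset H}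
    {Q : Finset (Equiv.Perm H)} (hQ : ∀ u ∈ U, ∀ v ∈ U, ∀ σ ∈ Q, Equiv.swap u v * σ ∈ Q)
    (hU : ∀ σ ∈ Q, ∀ h ∈ U, conjPairing τ₀ σ h ∈ U) {x y : H} (hx : x ∈ U) (hy : y ∈ U.erase x) :
    (U.card - 1) * (Q.filter (conjPairing τ₀ · x = y)).card = Q.card := by
  -- Composition with the transposition of `y` and `y'` exchanges the pairings with partner `y` and
  -- those with partner `y'`.
  have key : ∀ y' ∈ U.erase x, (Q.filter (conjPairing τ₀ · x = y')).card
      = (Q.filter (conjPairing τ₀ · x = y)).card := by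
    intro y' hy'
    simp only [Finset.mem_erase] at hy hy'
    refine Finset.card_bij' (fun σ _ => Equiv.swap y y' * σ) (fun σ _ => Equiv.swap y y' * σ)
      ?_ ?_ ?_ ?_
    · intro σ hσ
      simp only [Finset.mem_filter] at hσ ⊢
      refine ⟨hQ _ hy.2 _ hy'.2 _ hσ.1, ?_⟩
      rw [conjPairing_swap_mul, Equiv.swap_apply_of_ne_of_ne hy.1.symm hy'.1.symm, hσ.2]
      simp
    · intro σ hσ
      simp only [Finset.mem_filter] at hσ ⊢
      refine ⟨hQ _ hy.2 _ hy'.2 _ hσ.1, ?_⟩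
      rw [conjPairing_swap_mul, Equiv.swap_apply_of_ne_of_ne hy.1.symm hy'.1.symm, hσ.2]
      simp
    · intro σ _; simp [← mul_assoc]
    · intro σ _; simp [← mul_assoc]
  have hsum : Q.card = ∑ y' ∈ U.erase x, (Q.filter (conjPairing τ₀ · x = y')).card :=
    Finset.card_eq_sum_card_fiberwise fun σ hσ =>
      Finset.mem_erase.2 ⟨conjPairing_ne h₀ σ x, hU σ hσ x hx⟩
  rw [hsum, Finset.sum_congr rfl key, Finset.sum_const, Finset.card_erase_of_mem hx, smul_eq_mul]

variable {a : H → V} {k : ℕ}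

/-- The average of `z ^ |A|` after one step. -/
theorem sum_pow_card_hit_le {U : Finset H} {s : Finset H × Finset H} (hs : Valid a k U s)
    (hk : 3 ≤ k) {x : H} (hx : x ∈ s.1) {z q r η : ℝ} (hz0 : 0 < z) (hz1 : z ≤ 1)
    (hr : η + q * z ^ k + (1 - q) * z ≤ r * z ^ 2)
    (hA : ((s.1.card : ℝ)) ≤ η * ((U.card : ℝ) - 1))
    (hL : q * ((U.card : ℝ) - 1) ≤ (light a k s.2).card) :
    ∑ y ∈ U.erase x, z ^ (hit a k (s.1.erase x, s.2) y).1.card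
      ≤ r * z ^ s.1.card * ((U.card : ℝ) - 1) := by
  have hv := hs.erase x hx
  have hlight : light a k s.2 ⊆ s.2 := Finset.filter_subset _ _
  have hcA := Finset.card_erase_add_one hx
  have hU : U.erase x = s.1.erase x ∪ (light a k s.2 ∪ (s.2 \ light a k s.2)) := by
    rw [Finset.union_sdiff_of_subset hlight, hv.union]
  have hd1 : Disjoint (s.1.erase x) (light a k s.2 ∪ (s.2 \ light a k s.2)) := by
    rw [Finset.union_sdiff_of_subset hlight]; exact hv.disj
  have hUc : (U.card : ℝ) - 1 = ((s.1.erase x).card : ℝ) + ((light a k s.2).card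
      + (s.2 \ light a k s.2).card) := by
    have : U.card = s.1.card + s.2.card := by rw [← hs.union, Finset.card_union_of_disjoint hs.disj]
    have h2 := Finset.card_sdiff_add_card_eq_card hlight
    rw [this, ← h2, ← hcA]; push_cast; ring
  set w := (s.1.erase x).card with hw
  -- The new exponent is `|A| - 2`, `|A| + k - 2` or `|A| - 1` according as the partner is active,
  -- light or heavier. The factor `z ^ 2` avoids truncated subtraction.
  have e1 : ∀ y ∈ s.1.erase x, z ^ 2 * z ^ (hit a k (s.1.erase x, s.2) y).1.card
      = z ^ s.1.card := by
    intro y hy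
    rw [hit_of_mem_active hv hy]
    have := Finset.card_erase_add_one hy
    rw [← pow_add]; congr 1; dsimp only; omega
  have e2 : ∀ y ∈ light a k s.2, z ^ 2 * z ^ (hit a k (s.1.erase x, s.2) y).1.card
      = z ^ s.1.card * z ^ k := by
    intro y hy
    have := card_hit_of_mem_light hv hy
    rw [← pow_add, ← pow_add]; congr 1; dsimp only at this; omega
  have e3 : ∀ y ∈ s.2 \ light a k s.2, z ^ 2 * z ^ (hit a k (s.1.erase x, s.2) y).1.card
      = z ^ s.1.card * z := by
    intro y hy
    rw [Finset.mem_sdiff] at hy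
    rw [hit_of_not_mem_light (s := (s.1.erase x, s.2)) hy.1 hy.2]
    rw [← pow_add, ← pow_succ]; congr 1; dsimp only; omega
  have hz2 : 0 < z ^ 2 := by positivity
  rw [← mul_le_mul_iff_right₀ hz2, Finset.mul_sum, hU, Finset.sum_union hd1,
    Finset.sum_union Finset.disjoint_sdiff, Finset.sum_congr rfl e1, Finset.sum_congr rfl e2,
    Finset.sum_congr rfl e3]
  simp only [Finset.sum_const, nsmul_eq_mul]
  have hZ : 0 < z ^ s.1.card := by positivity
  rw [← hw]
  have hzk : z ^ k ≤ z := by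
    calc z ^ k ≤ z ^ 1 := pow_le_pow_of_le_one hz0.le hz1 (by omega)
      _ = z := pow_one z
  rw [← hcA] at hA
  push_cast at hA
  set M := (U.card : ℝ) - 1 with hM
  set l : ℝ := ((light a k s.2).card : ℝ)
  set d : ℝ := ((s.2 \ light a k s.2).card : ℝ)
  have hM0 : 0 ≤ M := by rw [hUc]; positivity
  -- Since `z ^ k ≤ z ≤ 1`, the sum decreases with the number of light points and increases with the
  -- number of active ones, so these may be replaced by their bounds `q M` and `η M`.
  have h3 : (w : ℝ) + l * z ^ k + d * z ≤ r * z ^ 2 * M := by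
    calc (w : ℝ) + l * z ^ k + d * z = w * (1 - z) + M * z - l * (z - z ^ k) := by
            rw [hUc]; ring
      _ ≤ (η * M) + M * z - (q * M) * (z - z ^ k) := by
            have t1 : (w : ℝ) * (1 - z) ≤ η * M := by
              have : (0 : ℝ) ≤ w := by positivity
              nlinarith
            have t2 := mul_le_mul_of_nonneg_right hL (sub_nonneg.2 hzk)
            linarith
      _ = (η + q * z ^ k + (1 - q) * z) * M := by ring
      _ ≤ r * z ^ 2 * M := by gcongr
  calc (w : ℝ) * z ^ s.1.card + (l * (z ^ s.1.card * z ^ k) + d * (z ^ s.1.card * z))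
      = z ^ s.1.card * (w + l * z ^ k + d * z) := by ring
    _ ≤ z ^ s.1.card * (r * z ^ 2 * M) := by gcongr
    _ = _ := by ring

/-- The number of permutations for which the deletion process survives `j` steps and dies within
`t` steps. -/
theorem card_filter_dies_le {τ₀ : H → H} (h₀ : Function.Involutive τ₀) (h₀' : ∀ h, τ₀ h ≠ h)
    (hk : 3 ≤ k) {z q r η : ℝ} (hz0 : 0 < z) (hz1 : z ≤ 1) (hr0 : 0 < r) (hr1 : r ≤ 1) (hq : 0 ≤ q)
    (hη : 0 ≤ η) (hr : η + q * z ^ k + (1 - q) * z ≤ r * z ^ 2) {N P : ℝ} :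
    ∀ (t j : ℕ) (U : Finset H) (s : Finset H × Finset H) (Q : Finset (Equiv.Perm H)),
    Valid a k U s → (∀ u ∈ U, ∀ v ∈ U, ∀ σ ∈ Q, Equiv.swap u v * σ ∈ Q) →
    (∀ σ ∈ Q, ∀ h ∈ U, conjPairing τ₀ σ h ∈ U) →
    (U.card : ℝ) ≤ N → P + 2 * t + 1 ≤ U.card → q * N + k * t ≤ (light a k s.2).card →
    (s.1.card : ℝ) + k * t ≤ η * P →
    ((Q.filter fun σ => ((step a k (conjPairing τ₀ σ))^[t] s).1 = ∅ ∧
      ∀ i < j, ((step a k (conjPairing τ₀ σ))^[i] s).1 ≠ ∅).card : ℝ)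
      ≤ r ^ j * z ^ s.1.card * Q.card := by
  classical
  intro t
  induction t with
  | zero =>
    intro j U s Q hs hQ hU _ _ _ _
    by_cases h : s.1 = ∅ ∧ j = 0
    · simp only [h, Function.iterate_zero, id]
      simp
    · rw [Finset.filter_false_of_mem]
      · simp; positivity
      · rintro σ _ ⟨h1, h2⟩
        simp only [Function.iterate_zero, id] at h1
        refine h ⟨h1, ?_⟩
        by_contra hj
        exact h2 0 (by omega) (by simpa using h1)
  | succ t ih =>
    intro j U s Q hs hQ hU hN hP hl hA
    rcases s.1.eq_empty_or_nonempty with h0 | h0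
    · rcases Nat.eq_zero_or_pos j with rfl | hj
      · simp only [h0, Finset.card_empty, pow_zero, one_mul]
        exact_mod_cast Finset.card_filter_le _ _
      · rw [Finset.filter_false_of_mem]
        · simp; positivity
        · rintro σ _ ⟨h1, h2⟩
          exact h2 0 hj (by simpa using h0)
    obtain ⟨x, hx, hst⟩ := exists_step_eq_hit a k h0
    have hxU : x ∈ U := by rw [← hs.union]; exact Finset.mem_union_left _ hx
    push_cast at hP hl hA
    have hkpos : (3 : ℝ) ≤ k := by exact_mod_cast hk
    have hUpos : 0 < (U.card : ℝ) - 1 := by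
      have : 0 ≤ P := by
        by_contra hneg
        have h1 : η * P ≤ 0 := mul_nonpos_of_nonneg_of_nonpos hη (by linarith)
        have h2 : (0:ℝ) ≤ s.1.card + k * t := by positivity
        linarith
      have : (0 : ℝ) ≤ t := by positivity
      linarith
    have hcard : ∀ y ∈ U.erase x, ((Q.filter (conjPairing τ₀ · x = y)).card : ℝ)
        = Q.card / ((U.card : ℝ) - 1) := by
      intro y hy
      rw [eq_div_iff hUpos.ne']
      have := card_filter_conjPairing h₀' hQ hU hxU hy
      rw [← this]
      have h1 : 1 ≤ U.card := Finset.card_pos.2 ⟨x, hxU⟩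
      push_cast [Nat.cast_sub h1]; ring
    have hsub : (Q.filter fun σ => ((step a k (conjPairing τ₀ σ))^[t + 1] s).1 = ∅ ∧
        ∀ i < j, ((step a k (conjPairing τ₀ σ))^[i] s).1 ≠ ∅) ⊆
        (U.erase x).biUnion fun y => (Q.filter (conjPairing τ₀ · x = y)).filter fun σ =>
          ((step a k (conjPairing τ₀ σ))^[t] (hit a k (s.1.erase x, s.2) y)).1 = ∅ ∧
          ∀ i < j - 1, ((step a k (conjPairing τ₀ σ))^[i] (hit a k (s.1.erase x, s.2) y)).1 ≠ ∅ := by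
      intro σ hσ
      simp only [Finset.mem_filter] at hσ
      obtain ⟨hσQ, h1, h2⟩ := hσ
      simp only [Finset.mem_biUnion, Finset.mem_filter]
      refine ⟨conjPairing τ₀ σ x, Finset.mem_erase.2 ⟨conjPairing_ne h₀' σ x, hU σ hσQ x hxU⟩,
        ⟨hσQ, rfl⟩, ?_, fun i hi => ?_⟩
      · rw [Function.iterate_succ_apply, hst] at h1; exact h1
      · have := h2 (i + 1) (by omega)
        rwa [Function.iterate_succ_apply, hst] at this
    -- Given the partner `y` of `x`, the permutations still form a set invariant under the
    -- transpositions of the remaining points. The induction hypothesis applies, the budgets having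
    -- lost `2` points and at most `k` light points, and gained at most `k` active ones.
    have hbound : ∀ y ∈ U.erase x, (((Q.filter (conjPairing τ₀ · x = y)).filter fun σ =>
          ((step a k (conjPairing τ₀ σ))^[t] (hit a k (s.1.erase x, s.2) y)).1 = ∅ ∧
          ∀ i < j - 1, ((step a k (conjPairing τ₀ σ))^[i]
            (hit a k (s.1.erase x, s.2) y)).1 ≠ ∅).card : ℝ)
        ≤ r ^ (j - 1) * z ^ (hit a k (s.1.erase x, s.2) y).1.card *
          (Q.card / ((U.card : ℝ) - 1)) := by
      intro y hy
      rw [← hcard y hy]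
      have hv := (hs.erase x hx).hit y
      have hyx := (Finset.mem_erase.1 hy).1
      have hcU : (((U.erase x).erase y).card : ℝ) = U.card - 2 := by
        have h1 := Finset.card_erase_add_one hy
        have h2 := Finset.card_erase_add_one hxU
        have : ((U.erase x).erase y).card + 2 = U.card := by omega
        rw [← this]; push_cast; ring
      refine ih (j - 1) _ _ _ hv ?_ ?_ ?_ ?_ ?_ ?_
      · intro u hu v hv' σ hσ
        simp only [Finset.mem_filter, Finset.mem_erase] at hu hv' hσ ⊢
        refine ⟨hQ u hu.2.2 v hv'.2.2 σ hσ.1, ?_⟩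
        rw [conjPairing_swap_mul, Equiv.swap_apply_of_ne_of_ne hu.2.1.symm hv'.2.1.symm, hσ.2,
          Equiv.swap_apply_of_ne_of_ne hu.1.symm hv'.1.symm]
      · intro σ hσ h hh
        have hinv := conjPairing_involutive h₀ σ
        simp only [Finset.mem_filter, Finset.mem_erase] at hσ hh ⊢
        refine ⟨fun e => hh.2.1 (hinv.injective (e.trans hσ.2.symm)), fun e => hh.1 ?_,
          hU σ hσ.1 h hh.2.2⟩
        rw [← hσ.2, ← e, hinv h]
      · rw [hcU]; linarith
      · rw [hcU]; linarith
      · have := card_light_le_hit (a := a) (k := k) (s := (s.1.erase x, s.2)) y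
        have : ((light a k s.2).card : ℝ) ≤
            (light a k (hit a k (s.1.erase x, s.2) y).2).card + k := by exact_mod_cast this
        linarith
      · have h1 := card_active_hit (a := a) (k := k) (s := (s.1.erase x, s.2)) y
        have h2 := card_image_le_hit (a := a) (k := k) (s := (s.1.erase x, s.2)) y
        have h3 := Finset.card_erase_add_one hx
        have h4 := Nat.mul_le_mul_left (k - 1) h2
        rw [Nat.mul_add] at h4
        dsimp only at h1 h4
        have h5 : (hit a k (s.1.erase x, s.2) y).1.card ≤ s.1.card + k := by omega
        have : ((hit a k (s.1.erase x, s.2) y).1.card : ℝ) ≤ s.1.card + k := by exact_mod_cast h5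
        linarith
    have ht0 : (0 : ℝ) ≤ t := by positivity
    have hsum := sum_pow_card_hit_le hs hk hx hz0 hz1 hr
      (by
        have : η * P ≤ η * ((U.card : ℝ) - 1) := by
          apply mul_le_mul_of_nonneg_left _ hη; linarith
        have : (0:ℝ) ≤ k * (t + 1) := by positivity
        linarith)
      (by
        have : q * ((U.card : ℝ) - 1) ≤ q * N := by
          apply mul_le_mul_of_nonneg_left _ hq; linarith
        have : (0:ℝ) ≤ k * (t + 1) := by positivity
        linarith)
    calc ((Q.filter fun σ => ((step a k (conjPairing τ₀ σ))^[t + 1] s).1 = ∅ ∧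
          ∀ i < j, ((step a k (conjPairing τ₀ σ))^[i] s).1 ≠ ∅).card : ℝ)
        ≤ ∑ y ∈ U.erase x, (((Q.filter (conjPairing τ₀ · x = y)).filter fun σ =>
          ((step a k (conjPairing τ₀ σ))^[t] (hit a k (s.1.erase x, s.2) y)).1 = ∅ ∧
          ∀ i < j - 1, ((step a k (conjPairing τ₀ σ))^[i]
            (hit a k (s.1.erase x, s.2) y)).1 ≠ ∅).card : ℝ) := by
          exact_mod_cast (Finset.card_le_card hsub).trans Finset.card_biUnion_le
      _ ≤ ∑ y ∈ U.erase x, r ^ (j - 1) * z ^ (hit a k (s.1.erase x, s.2) y).1.card *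
          (Q.card / ((U.card : ℝ) - 1)) := Finset.sum_le_sum hbound
      _ = r ^ (j - 1) * (Q.card / ((U.card : ℝ) - 1)) *
          ∑ y ∈ U.erase x, z ^ (hit a k (s.1.erase x, s.2) y).1.card := by
          rw [Finset.mul_sum]; exact Finset.sum_congr rfl fun _ _ => by ring
      _ ≤ r ^ (j - 1) * (Q.card / ((U.card : ℝ) - 1)) *
          (r * z ^ s.1.card * ((U.card : ℝ) - 1)) := by gcongr
      _ = r ^ (j - 1 + 1) * z ^ s.1.card * Q.card := by
          rw [pow_succ]; field_simp
      -- For `j = 0` the exponent `j - 1 + 1` is `1`, and `r ≤ 1` closes the gap.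
      _ ≤ r ^ j * z ^ s.1.card * Q.card := by
          gcongr ?_ * _ * _
          exact pow_le_pow_of_le_one hr0.le hr1 (by omega)

end Counting

/-! ### Half-edges of the multigraph, and the core as the outcome of the process -/

section HalfEdges

variable {n m : ℕ}

/-- The first half-edge of the edge `i`. -/
def firstHalf (i : Fin m) : Fin (2 * m) := ⟨i, by omega⟩

/-- The second half-edge of the edge `i`. -/
def secondHalf (i : Fin m) : Fin (2 * m) := ⟨m + i, by omega⟩

/-- The edge of a half-edge. -/
def edgeOf (p : Fin (2 * m)) : Fin m :=
  if h : (p : ℕ) < m then ⟨p, h⟩ else ⟨p - m, by omega⟩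

/-- The other half-edge of the same edge. -/
def partner (p : Fin (2 * m)) : Fin (2 * m) :=
  if h : (p : ℕ) < m then ⟨m + p, by omega⟩ else ⟨p - m, by omega⟩

theorem edgeOf_firstHalf (i : Fin m) : edgeOf (firstHalf i) = i := by
  simp [edgeOf, firstHalf]

theorem edgeOf_secondHalf (i : Fin m) : edgeOf (secondHalf i) = i := by
  simp [edgeOf, secondHalf]

theorem firstHalf_ne_secondHalf (i j : Fin m) : firstHalf i ≠ secondHalf j := by
  simp only [firstHalf, secondHalf, ne_eq, Fin.mk.injEq]; omega

theorem eq_firstHalf_or_eq_secondHalf (p : Fin (2 * m)) :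
    p = firstHalf (edgeOf p) ∨ p = secondHalf (edgeOf p) := by
  unfold edgeOf
  split_ifs with h
  · left; simp [firstHalf]
  · right; ext; simp only [secondHalf]; omega

theorem partner_firstHalf (i : Fin m) : partner (firstHalf i) = secondHalf i := by
  simp [partner, firstHalf, secondHalf]

theorem partner_secondHalf (i : Fin m) : partner (secondHalf i) = firstHalf i := by
  simp [partner, firstHalf, secondHalf]

theorem partner_involutive : Function.Involutive (partner (m := m)) := by
  intro p
  rcases eq_firstHalf_or_eq_secondHalf p with h | h <;> rw [h] <;>
    simp only [partner_firstHalf, partner_secondHalf]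

theorem partner_ne (p : Fin (2 * m)) : partner p ≠ p := by
  rcases eq_firstHalf_or_eq_secondHalf p with h | h <;> rw [h] <;>
    simp only [partner_firstHalf, partner_secondHalf]
  · exact (firstHalf_ne_secondHalf _ _).symm
  · exact firstHalf_ne_secondHalf _ _

theorem edgeOf_partner (p : Fin (2 * m)) : edgeOf (partner p) = edgeOf p := by
  rcases eq_firstHalf_or_eq_secondHalf p with h | h <;>
    conv_lhs => rw [h]
  · rw [partner_firstHalf, edgeOf_secondHalf]
  · rw [partner_secondHalf, edgeOf_firstHalf]

theorem allocGraph_isLink {b : Fin (2 * m) → Fin n} {i : Fin m} {x y : Fin n} :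
    (allocGraph b).IsLink i x y ↔ (x = b (firstHalf i) ∧ y = b (secondHalf i)) ∨
      (y = b (firstHalf i) ∧ x = b (secondHalf i)) := Iff.rfl

-- If `S` and `T` are the sets of edges whose first, respectively second, half-edge is at `v`, then
-- the incident edges are `S ∪ T` and the loops `S ∩ T`, so the degree is `|S| + |T|`.
open Classical in
theorem degree_eq_card {b : Fin (2 * m) → Fin n} {K : Graph (Fin n) (Fin m)}
    (hK : K ≤ allocGraph b) (v : Fin n) :
    degree K v = (Finset.univ.filter fun p => edgeOf p ∈ K.edgeSet ∧ b p = v).card := by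
  have hlink : ∀ e x y, K.IsLink e x y ↔ e ∈ K.edgeSet ∧
      ((x = b (firstHalf e) ∧ y = b (secondHalf e)) ∨
      (y = b (firstHalf e) ∧ x = b (secondHalf e))) := by
    intro e x y
    rw [← allocGraph_isLink]
    exact ⟨fun h => ⟨h.edge_mem, h.mono hK⟩, fun h => (hK.isLink_iff h.1).2 h.2⟩
  have h1 : {e | K.Inc e v} = {e | e ∈ K.edgeSet ∧ b (firstHalf e) = v} ∪
      {e | e ∈ K.edgeSet ∧ b (secondHalf e) = v} := by
    ext e
    simp only [Graph.Inc, hlink, Set.mem_ofPred_eq, Set.mem_union]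
    constructor
    · rintro ⟨y, h, (h' | h')⟩
      · exact Or.inl ⟨h, h'.1.symm⟩
      · exact Or.inr ⟨h, h'.2.symm⟩
    · rintro (h | h)
      · exact ⟨_, h.1, Or.inl ⟨h.2.symm, rfl⟩⟩
      · exact ⟨_, h.1, Or.inr ⟨rfl, h.2.symm⟩⟩
  have h2 : {e | K.IsLoopAt e v} = {e | e ∈ K.edgeSet ∧ b (firstHalf e) = v} ∩
      {e | e ∈ K.edgeSet ∧ b (secondHalf e) = v} := by
    ext e
    simp only [Graph.IsLoopAt, hlink, Set.mem_ofPred_eq, Set.mem_inter_iff]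
    constructor
    · rintro ⟨h, (h' | h')⟩ <;> exact ⟨⟨h, by tauto⟩, ⟨h, by tauto⟩⟩
    · rintro ⟨h, h'⟩
      exact ⟨h.1, Or.inl ⟨h.2.symm, h'.2.symm⟩⟩
  have hf : Function.Injective (firstHalf (m := m)) :=
    Function.LeftInverse.injective edgeOf_firstHalf
  have hs : Function.Injective (secondHalf (m := m)) :=
    Function.LeftInverse.injective edgeOf_secondHalf
  have h3 : ((Finset.univ.filter fun p => edgeOf p ∈ K.edgeSet ∧ b p = v : Finset _) : Set _) =
      firstHalf '' {e | e ∈ K.edgeSet ∧ b (firstHalf e) = v} ∪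
      secondHalf '' {e | e ∈ K.edgeSet ∧ b (secondHalf e) = v} := by
    ext p
    simp only [Finset.coe_filter, Finset.mem_univ, true_and, Set.mem_ofPred_eq, Set.mem_union,
      Set.mem_image]
    constructor
    · rintro ⟨h, h'⟩
      rcases eq_firstHalf_or_eq_secondHalf p with hp | hp
      · exact Or.inl ⟨_, ⟨h, hp ▸ h'⟩, hp.symm⟩
      · exact Or.inr ⟨_, ⟨h, hp ▸ h'⟩, hp.symm⟩
    · rintro (⟨e, h, rfl⟩ | ⟨e, h, rfl⟩)
      · rwa [edgeOf_firstHalf]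
      · rwa [edgeOf_secondHalf]
  rw [degree, h1, h2, Set.ncard_union_add_ncard_inter _ _ (Set.toFinite _) (Set.toFinite _),
    ← Set.ncard_coe_finset, h3, Set.ncard_union_eq _ (Set.toFinite _) (Set.toFinite _),
    Set.ncard_image_of_injective _ hf, Set.ncard_image_of_injective _ hs]
  rw [Set.disjoint_left]
  rintro _ ⟨e, _, rfl⟩ ⟨e', _, h⟩
  exact firstHalf_ne_secondHalf _ _ h.symm

/-- The state of the deletion process after the removal of the edge with half-edges `x`, `y`. -/
def start {H V : Type*} [Fintype H] [DecidableEq H] [DecidableEq V] (a : H → V) (k : ℕ) (x y : H) :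
    Finset H × Finset H :=
  hit a k (hit a k (∅, Finset.univ) x) y

theorem valid_start {H V : Type*} [Fintype H] [DecidableEq H] [DecidableEq V] {a : H → V} {k : ℕ}
    (ha : ∀ h, k ≤ (Finset.univ.filter (a · = a h)).card) (x y : H) :
    Valid a k ((Finset.univ.erase x).erase y) (start a k x y) := by
  have h : Valid a k Finset.univ ((∅, Finset.univ) : Finset H × Finset H) :=
    ⟨Finset.disjoint_empty_left _, by simp, fun y _ => ha y⟩
  exact (h.hit x).hit y

variable {k : ℕ}

/-- The points of the core edges form a set closed under the pairing, with all fibres of size at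
least `k` and without the two points of the edge `i`; the process never enters it. -/
theorem card_vertexSet_kCore_le (hk : 1 ≤ k) {a : Fin (2 * m) → Fin n}
    (ha : ∀ h, k ≤ (Finset.univ.filter (a · = a h)).card) (σ : Equiv.Perm (Fin (2 * m)))
    (i : Fin m) (t : ℕ) :
    (kCore k ((allocGraph (a ∘ σ)).deleteEdges {i})).vertexSet.ncard ≤
      (((step a k (conjPairing partner σ))^[t]
        (start a k (σ (firstHalf i)) (σ (secondHalf i)))).2.image a).card := by
  classical
  obtain ⟨⟨hle, hdeg⟩, -⟩ := isGreatest_kCore k ((allocGraph (a ∘ σ)).deleteEdges {i})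
  set K := kCore k ((allocGraph (a ∘ σ)).deleteEdges {i}) with hKdef
  have hle' : K ≤ allocGraph (a ∘ σ) := hle.trans Graph.deleteEdges_le
  have hi : i ∉ K.edgeSet := fun h => by
    have := hle.edgeSet_mono h
    simp at this
  set C : Finset (Fin (2 * m)) := Finset.univ.filter fun h => edgeOf (σ.symm h) ∈ K.edgeSet with hC
  have hcard : ∀ v, degree K v = (C.filter (a · = v)).card := by
    intro v
    rw [degree_eq_card hle']
    refine Finset.card_bij' (fun p _ => σ p) (fun h _ => σ.symm h) ?_ ?_ ?_ ?_ <;>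
      simp [hC]
  have hCfib : ∀ h ∈ C, k ≤ (C.filter (a · = a h)).card := by
    intro h hh
    rw [← hcard]
    apply hdeg
    have he : edgeOf (σ.symm h) ∈ K.edgeSet := by simpa [hC] using hh
    obtain ⟨x, y, hxy⟩ := Graph.exists_isLink_of_mem_edgeSet he
    have h1 := allocGraph_isLink.1 (hxy.mono hle')
    have : a h = (a ∘ σ) (σ.symm h) := by simp
    rcases eq_firstHalf_or_eq_secondHalf (σ.symm h) with hp | hp
    · rw [this, hp]
      rcases h1 with h1 | h1
      · rw [← h1.1]; exact hxy.left_mem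
      · rw [← h1.1]; exact hxy.right_mem
    · rw [this, hp]
      rcases h1 with h1 | h1
      · rw [← h1.2]; exact hxy.right_mem
      · rw [← h1.2]; exact hxy.left_mem
  have hxC : σ (firstHalf i) ∉ C := by simp [hC, edgeOf_firstHalf, hi]
  have hyC : σ (secondHalf i) ∉ C := by simp [hC, edgeOf_secondHalf, hi]
  have hv := valid_start ha (σ (firstHalf i)) (σ (secondHalf i))
  have hsub : C ⊆ (start a k (σ (firstHalf i)) (σ (secondHalf i))).2 :=
    subset_hit hCfib (subset_hit (s := (∅, Finset.univ)) hCfib (Finset.subset_univ _) hxC) hyC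
  have hL := subset_iterate_step hCfib (conjPairing_involutive partner_involutive σ)
    (by intro h hh; simpa [hC, conjPairing, edgeOf_partner] using hh) t _
    (hv.disj.mono_right hsub) hsub (by rw [hv.union]; exact hv)
  rw [← Set.ncard_coe_finset]
  refine Set.ncard_le_ncard ?_ (Set.toFinite _)
  intro v hvK
  have h1 := hdeg v hvK
  rw [hcard] at h1
  obtain ⟨h, hh⟩ := Finset.card_pos.1 (lt_of_lt_of_le hk h1)
  rw [Finset.mem_filter] at hh
  rw [← hh.2]
  exact Finset.mem_coe.2 (Finset.mem_image_of_mem _ (hL hh.1))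

/-- After extinction the surviving points carry a subgraph `K` of minimum degree at least `k` that
avoids the edge `i`; by maximality it lies in the core. -/
theorem card_image_le_card_vertexSet_kCore {a : Fin (2 * m) → Fin n}
    (ha : ∀ h, k ≤ (Finset.univ.filter (a · = a h)).card) (σ : Equiv.Perm (Fin (2 * m)))
    (i : Fin m) (t : ℕ) (ht : ((step a k (conjPairing partner σ))^[t]
        (start a k (σ (firstHalf i)) (σ (secondHalf i)))).1 = ∅) :
    (((step a k (conjPairing partner σ))^[t]
        (start a k (σ (firstHalf i)) (σ (secondHalf i)))).2.image a).card ≤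
      (kCore k ((allocGraph (a ∘ σ)).deleteEdges {i})).vertexSet.ncard := by
  classical
  have hinv := conjPairing_involutive partner_involutive σ
  have hσ1 : conjPairing partner σ (σ (firstHalf i)) = σ (secondHalf i) := by
    simp [conjPairing, partner_firstHalf]
  have hσ2 : conjPairing partner σ (σ (secondHalf i)) = σ (firstHalf i) := by
    simp [conjPairing, partner_secondHalf]
  obtain ⟨U', hU', hv, hcl⟩ := valid_iterate_step hinv t _ _
    (valid_start ha (σ (firstHalf i)) (σ (secondHalf i))) (by
      intro h hh
      simp only [Finset.mem_erase, Finset.mem_univ, and_true] at hh ⊢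
      exact ⟨fun e => hh.2 (hinv.injective (e.trans hσ1.symm)),
        fun e => hh.1 (hinv.injective (e.trans hσ2.symm))⟩)
  set L := ((step a k (conjPairing partner σ))^[t]
        (start a k (σ (firstHalf i)) (σ (secondHalf i)))).2 with hL
  have hLU : U' = L := by rw [← hv.union, ht, Finset.empty_union]
  rw [hLU] at hU' hcl
  have hhalf : ∀ p, σ p ∈ L → σ (firstHalf (edgeOf p)) ∈ L ∧ σ (secondHalf (edgeOf p)) ∈ L := by
    intro p hp
    have h1 : σ (partner p) ∈ L := by simpa [conjPairing] using hcl _ hp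
    rcases eq_firstHalf_or_eq_secondHalf p with h | h
    · have h2 : partner p = secondHalf (edgeOf p) := by
        conv_lhs => rw [h]
        exact partner_firstHalf _
      exact ⟨h ▸ hp, h2 ▸ h1⟩
    · have h2 : partner p = firstHalf (edgeOf p) := by
        conv_lhs => rw [h]
        exact partner_secondHalf _
      exact ⟨h2 ▸ h1, h ▸ hp⟩
  let K : Graph (Fin n) (Fin m) :=
    { vertexSet := (L.image a : Finset (Fin n))
      IsLink := fun e x y => σ (firstHalf e) ∈ L ∧ (allocGraph (a ∘ σ)).IsLink e x y
      isLink_symm := fun _ _ => ⟨fun _ _ h => ⟨h.1, h.2.symm⟩⟩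
      eq_or_eq_of_isLink_of_isLink := fun _ _ _ _ _ h h' => h.2.left_eq_or_eq h'.2
      left_mem_of_isLink := by
        rintro e x y ⟨h, h'⟩
        have h2 := hhalf _ h
        rw [edgeOf_firstHalf] at h2
        rw [Finset.mem_coe]
        rcases allocGraph_isLink.1 h' with h' | h'
        · rw [h'.1]; exact Finset.mem_image_of_mem a h2.1
        · rw [h'.2]; exact Finset.mem_image_of_mem a h2.2 }
  have hKG : K ≤ allocGraph (a ∘ σ) := ⟨Set.subset_univ _, fun _ _ _ h => h.2⟩
  have hKe : K ≤ (allocGraph (a ∘ σ)).deleteEdges {i} := by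
    refine ⟨Set.subset_univ _, fun e x y h => ?_⟩
    rw [Graph.deleteEdges_isLink]
    refine ⟨h.2, ?_⟩
    rintro rfl
    have := hU' h.1
    simp at this
  have hdeg : MinDegreeGE k K := by
    intro v hvK
    obtain ⟨h, hh, rfl⟩ := Finset.mem_image.1 (Finset.mem_coe.1 hvK)
    rw [degree_eq_card hKG]
    refine (hv.fibre h hh).trans ?_
    refine Finset.card_le_card_of_injOn (fun h => σ.symm h) ?_ σ.symm.injective.injOn
    intro g hg
    simp only [Finset.coe_filter, Set.mem_ofPred_eq] at hg
    simp only [Finset.coe_filter, Finset.mem_univ, true_and, Set.mem_ofPred_eq,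
      Function.comp_apply, Equiv.apply_symm_apply]
    refine ⟨?_, hg.2⟩
    exact Graph.IsLink.edge_mem (G := K) (x := (a ∘ σ) (firstHalf (edgeOf (σ.symm g))))
      (y := (a ∘ σ) (secondHalf (edgeOf (σ.symm g))))
      ⟨(hhalf (σ.symm g) (by simpa using hg.1)).1, allocGraph_isLink.2 (Or.inl ⟨rfl, rfl⟩)⟩
  rw [← Set.ncard_coe_finset]
  exact Set.ncard_le_ncard (le_kCore hKe hdeg).vertexSet_mono (Set.toFinite _)

end HalfEdges

/-! ### Switchings and concentration of the balance equations -/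

section Switching

set_option linter.unusedSectionVars false

variable {H V : Type*} [Fintype H] [DecidableEq H] [Fintype V] [DecidableEq V]

/-- The number of points that `a` allocates to `v`. -/
def load (a : H → V) (v : V) : ℕ := (Finset.univ.filter fun h => a h = v).card

/-- The number of points other than `h` that `a` allocates to `v`. -/
def loadOff (a : H → V) (h : H) (v : V) : ℕ := (Finset.univ.filter fun g => g ≠ h ∧ a g = v).card

/-- The number of vertices of load `j`. -/
def loadCount (a : H → V) (j : ℕ) : ℕ := (Finset.univ.filter fun v => load a v = j).card

/-- The allocations in which every vertex has load at least `k`. -/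
def allocFinset (H V : Type*) [Fintype H] [DecidableEq H] [Fintype V] [DecidableEq V] (k : ℕ) :
    Finset (H → V) :=
  Finset.univ.filter fun a => ∀ v, k ≤ load a v

theorem load_eq_loadOff_add (a : H → V) (h : H) (v : V) :
    load a v = loadOff a h v + if a h = v then 1 else 0 := by
  unfold load loadOff
  split_ifs with hv
  · have : (Finset.univ.filter fun g => g ≠ h ∧ a g = v)
        = (Finset.univ.filter fun g => a g = v).erase h := by ext g; simp
    rw [this, Finset.card_erase_add_one (by simpa using hv)]
  · congr 1; ext g
    simp only [Finset.mem_filter, Finset.mem_univ, true_and]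
    exact ⟨fun hg => ⟨fun e => hv (e ▸ hg), hg⟩, fun hg => hg.2⟩

theorem loadOff_update (a : H → V) (h : H) (u v : V) :
    loadOff (Function.update a h u) h v = loadOff a h v := by
  unfold loadOff
  congr 1; ext g
  simp only [Finset.mem_filter, Finset.mem_univ, true_and]
  refine and_congr_right fun hg => ?_
  rw [Function.update_of_ne hg]

theorem load_update (a : H → V) (h : H) (u v : V) :
    load (Function.update a h u) v = loadOff a h v + if u = v then 1 else 0 := by
  rw [load_eq_loadOff_add _ h, loadOff_update, Function.update_self]

theorem card_filter_load_comp (a : H → V) (j : ℕ) :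
    (Finset.univ.filter fun h => load a (a h) = j).card = j * loadCount a j := by
  have h1 := Finset.card_eq_sum_card_fiberwise (f := a)
    (s := Finset.univ.filter fun h => load a (a h) = j)
    (t := Finset.univ.filter fun v => load a v = j) (by intro h; simp)
  rw [h1, loadCount, mul_comm, ← smul_eq_mul, ← Finset.sum_const]
  refine Finset.sum_congr rfl fun v hv => ?_
  simp only [Finset.mem_filter, Finset.mem_univ, true_and] at hv
  rw [← hv, load]
  congr 1; ext h
  simp only [Finset.mem_filter, Finset.mem_univ, true_and]
  constructor
  · exact fun h => h.2
  · rintro rfl; exact ⟨rfl, rfl⟩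

theorem mul_loadCount_le (a : H → V) (j : ℕ) : j * loadCount a j ≤ Fintype.card H := by
  rw [← card_filter_load_comp]; exact Finset.card_le_univ _

theorem loadCount_le (a : H → V) (j : ℕ) : loadCount a j ≤ Fintype.card V := Finset.card_le_univ _

theorem card_filter_lt_load {k : ℕ} {a : H → V} (ha : a ∈ allocFinset H V k) :
    ((Finset.univ.filter fun h => k < load a (a h)).card : ℝ)
      = Fintype.card H - k * loadCount a k := by
  have h1 := Finset.card_filter_add_card_filter_not (s := Finset.univ)
    (fun h => load a (a h) = k)
  have h2 : (Finset.univ.filter fun h => ¬ load a (a h) = k)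
      = Finset.univ.filter fun h => k < load a (a h) := by
    simp only [allocFinset, Finset.mem_filter, Finset.mem_univ, true_and] at ha
    ext h
    have := ha (a h)
    simp only [Finset.mem_filter, Finset.mem_univ, true_and]
    omega
  rw [h2, card_filter_load_comp, Finset.card_univ] at h1
  rw [← h1]; push_cast; ring

/-- Ignoring the point `h` changes the load of the vertex `a h` only. -/
theorem abs_card_loadOff_sub_le (a : H → V) (h : H) (j : ℕ) :
    |((Finset.univ.filter fun v => loadOff a h v = j).card : ℝ) - loadCount a j| ≤ 1 := by
  have key : ∀ v ≠ a h, load a v = loadOff a h v := by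
    intro v hv; rw [load_eq_loadOff_add a h, if_neg hv.symm, add_zero]
  have h1 : (Finset.univ.filter fun v => loadOff a h v = j).card ≤ loadCount a j + 1 := by
    refine (Finset.card_le_card (t := insert (a h) (Finset.univ.filter fun v => load a v = j))
      fun v hv => ?_).trans (Finset.card_insert_le _ _)
    by_cases hva : v = a h
    · simp [hva]
    · simpa [hva, key v hva] using hv
  have h2 : loadCount a j ≤ (Finset.univ.filter fun v => loadOff a h v = j).card + 1 := by
    refine (Finset.card_le_card (t := insert (a h) (Finset.univ.filter fun v => loadOff a h v = j))
      fun v hv => ?_).trans (Finset.card_insert_le _ _)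
    by_cases hva : v = a h
    · simp [hva]
    · simpa [hva, key v hva] using hv
  have h1' : ((Finset.univ.filter fun v => loadOff a h v = j).card : ℝ) ≤ loadCount a j + 1 := by
    exact_mod_cast h1
  have h2' : (loadCount a j : ℝ) ≤ (Finset.univ.filter fun v => loadOff a h v = j).card + 1 := by
    exact_mod_cast h2
  rw [abs_le]; constructor <;> linarith

theorem abs_loadCount_update_sub_le (a : H → V) (h : H) (u : V) (j : ℕ) :
    |(loadCount (Function.update a h u) j : ℝ) - loadCount a j| ≤ 2 := by
  have h1 := abs_card_loadOff_sub_le a h j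
  have h2 := abs_card_loadOff_sub_le (Function.update a h u) h j
  simp only [loadOff_update] at h2
  rw [abs_le] at h1 h2 ⊢
  constructor <;> linarith [h1.1, h1.2, h2.1, h2.2]

/-- Double counting of the ways to move one point, from a vertex of load greater than `k` to a vertex
which then has load `j + 1`. -/
theorem sum_switch {k j : ℕ} (hj : k ≤ j) (Φ : (H → V) → ℝ) :
    ∑ a ∈ allocFinset H V k, ∑ h, ∑ v,
        (if k < load a (a h) ∧ loadOff a h v = j then Φ a else 0)
      = ∑ a ∈ allocFinset H V k, ∑ h, ∑ u,
        (if load a (a h) = j + 1 then Φ (Function.update a h u) else 0) := by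
  have conv : ∀ g : (H → V) → H → V → ℝ,
      ∑ a ∈ allocFinset H V k, ∑ h, ∑ v, g a h v
        = ∑ y : (H → V) × H × V, if ∀ v, k ≤ load y.1 v then g y.1 y.2.1 y.2.2 else 0 := by
    intro g
    rw [allocFinset, Finset.sum_filter, Fintype.sum_prod_type]
    refine Finset.sum_congr rfl fun a _ => ?_
    split_ifs <;> simp [Fintype.sum_prod_type]
  rw [conv, conv]
  -- The switching: move the point `h` to `v` and remember its old vertex. Performing it twice
  -- restores the triple.
  have e : Function.Involutive
      (fun y : (H → V) × H × V => (Function.update y.1 y.2.1 y.2.2, y.2.1, y.1 y.2.1)) := by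
    rintro ⟨a, h, v⟩; simp
  refine Fintype.sum_equiv e.toPerm _ _ ?_
  rintro ⟨a, h, v⟩
  simp only [Function.Involutive.coe_toPerm, Function.update_idem, Function.update_eq_self,
    Function.update_self]
  rw [← ite_and, ← ite_and]
  refine if_congr ?_ rfl rfl
  simp only [load_update, if_true]
  constructor
  · rintro ⟨h1, h2, h3⟩
    refine ⟨fun w => ?_, by omega⟩
    have hw := h1 w
    rw [load_eq_loadOff_add a h] at hw
    rw [load_eq_loadOff_add a h, if_pos rfl] at h2
    by_cases hwa : a h = w
    · subst hwa; omega
    · rw [if_neg hwa] at hw; omega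
  -- The reverse move takes a point from a vertex of load `j + 1`; since `k ≤ j`, the load there
  -- stays at least `k`.
  · rintro ⟨h1, h2⟩
    have hall : ∀ w, k ≤ loadOff a h w := by
      intro w
      by_cases hwv : v = w
      · subst hwv; omega
      · have := h1 w; rwa [if_neg hwv, add_zero] at this
    refine ⟨fun w => ?_, ?_, by omega⟩
    · rw [load_eq_loadOff_add a h]; have := hall w; omega
    · rw [load_eq_loadOff_add a h, if_pos rfl]; have := hall (a h); omega

/-- The defect in the balance equation between the loads `j` and `j + 1`. -/
noncomputable def defect (k j : ℕ) (a : H → V) : ℝ :=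
  (Fintype.card H - k * loadCount a k) * loadCount a j
    - Fintype.card V * ((j + 1 : ℕ) * loadCount a (j + 1))

theorem abs_defect_le (k j : ℕ) (a : H → V) :
    |defect k j a| ≤ Fintype.card V * Fintype.card H := by
  have h1 : ((k * loadCount a k : ℕ) : ℝ) ≤ Fintype.card H := by
    exact_mod_cast mul_loadCount_le a k
  have h2 : (((j + 1) * loadCount a (j + 1) : ℕ) : ℝ) ≤ Fintype.card H := by
    exact_mod_cast mul_loadCount_le a (j + 1)
  have h3 : (loadCount a j : ℝ) ≤ Fintype.card V := by exact_mod_cast loadCount_le a j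
  rw [Nat.cast_mul] at h1 h2
  have h0 : (0 : ℝ) ≤ k * loadCount a k := by positivity
  have h5 : (0 : ℝ) ≤ (j + 1 : ℕ) * loadCount a (j + 1) := by positivity
  have h6 : (Fintype.card V : ℝ) * ((j + 1 : ℕ) * loadCount a (j + 1))
      ≤ Fintype.card V * Fintype.card H := by gcongr
  have h7 : (0 : ℝ) ≤ (Fintype.card H - k * loadCount a k) * loadCount a j :=
    mul_nonneg (by linarith) (by positivity)
  have h8 : (Fintype.card H - k * loadCount a k : ℝ) * loadCount a j
      ≤ Fintype.card H * Fintype.card V := by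
    apply mul_le_mul _ h3 (by positivity) (by positivity)
    linarith
  have h9 : (0 : ℝ) ≤ Fintype.card V * ((j + 1 : ℕ) * loadCount a (j + 1)) := by positivity
  rw [defect, abs_le]
  constructor <;> linarith

theorem abs_defect_update_sub_le (k j : ℕ) (a : H → V) (h : H) (u : V) :
    |defect k j (Function.update a h u) - defect k j a|
      ≤ 2 * Fintype.card H + 2 * (k + j + 1) * Fintype.card V := by
  have hk := abs_loadCount_update_sub_le a h u k
  have hj := abs_loadCount_update_sub_le a h u j
  have hj1 := abs_loadCount_update_sub_le a h u (j + 1)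
  have h1 : ((k * loadCount a k : ℕ) : ℝ) ≤ Fintype.card H := by
    exact_mod_cast mul_loadCount_le a k
  rw [Nat.cast_mul] at h1
  have h0 : (0 : ℝ) ≤ k * loadCount a k := by positivity
  have h3 : (loadCount (Function.update a h u) j : ℝ) ≤ Fintype.card V := by
    exact_mod_cast loadCount_le _ j
  have e : defect k j (Function.update a h u) - defect k j a
      = -(k * ((loadCount (Function.update a h u) k : ℝ) - loadCount a k)
          * loadCount (Function.update a h u) j)
        + (Fintype.card H - k * loadCount a k)
          * ((loadCount (Function.update a h u) j : ℝ) - loadCount a j)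
        + -(Fintype.card V * ((j + 1 : ℕ)
          * ((loadCount (Function.update a h u) (j + 1) : ℝ) - loadCount a (j + 1)))) := by
    simp only [defect]; ring
  rw [e]
  refine (abs_add_three _ _ _).trans ?_
  simp only [abs_neg, abs_mul, Nat.abs_cast]
  have hH : |(Fintype.card H - k * loadCount a k : ℝ)| ≤ Fintype.card H := by
    rw [abs_le]; constructor <;> linarith
  have b1 : (k : ℝ) * |(loadCount (Function.update a h u) k : ℝ) - loadCount a k|
      * loadCount (Function.update a h u) j ≤ k * 2 * Fintype.card V := by gcongr
  have b2 : |(Fintype.card H - k * loadCount a k : ℝ)|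
      * |(loadCount (Function.update a h u) j : ℝ) - loadCount a j| ≤ Fintype.card H * 2 := by
    gcongr
  have b3 : (Fintype.card V : ℝ) * ((j + 1 : ℕ)
      * |(loadCount (Function.update a h u) (j + 1) : ℝ) - loadCount a (j + 1)|)
      ≤ Fintype.card V * ((j + 1 : ℕ) * 2) := by gcongr
  push_cast at b3 ⊢
  linarith

/-- Apply `sum_switch` to the defect itself. Up to lower-order terms the two sides are the two terms
of the defect multiplied by the defect, so their difference is the sum of its squares. The errors
are small because one move changes the defect only by an amount linear in `|H|` and `|V|`. -/
theorem sum_sq_defect_le {k j : ℕ} (hj : k ≤ j) :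
    ∑ a ∈ allocFinset H V k, defect k j a ^ 2
      ≤ (allocFinset H V k).card * (Fintype.card V * Fintype.card H *
        (3 * Fintype.card H + 2 * (k + j + 1) * Fintype.card V)) := by
  set D : ℝ := 2 * Fintype.card H + 2 * (k + j + 1) * Fintype.card V with hD
  have hsw := sum_switch hj (defect (H := H) (V := V) k j)
  have hl : ∀ a : H → V, ∑ h, ∑ v,
      (if k < load a (a h) ∧ loadOff a h v = j then defect k j a else 0)
      = ∑ h ∈ Finset.univ.filter (fun h => k < load a (a h)),
        ((Finset.univ.filter fun v => loadOff a h v = j).card : ℝ) * defect k j a := by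
    intro a
    rw [Finset.sum_filter]
    refine Finset.sum_congr rfl fun h _ => ?_
    split_ifs with hh
    · simp only [hh, true_and, ← Finset.sum_filter, Finset.sum_const, nsmul_eq_mul]
    · simp [hh]
  have hr : ∀ a : H → V, ∑ h, ∑ u,
      (if load a (a h) = j + 1 then defect k j (Function.update a h u) else 0)
      = ∑ h ∈ Finset.univ.filter (fun h => load a (a h) = j + 1),
        ∑ u, defect k j (Function.update a h u) := by
    intro a
    rw [Finset.sum_filter]
    refine Finset.sum_congr rfl fun h _ => ?_
    split_ifs with hh <;> simp
  simp only [hl, hr] at hsw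
  have hfl : ∀ a ∈ allocFinset H V k,
      (Fintype.card H - k * loadCount a k) * loadCount a j * defect k j a
      ≤ ∑ h ∈ Finset.univ.filter (fun h => k < load a (a h)),
        ((Finset.univ.filter fun v => loadOff a h v = j).card : ℝ) * defect k j a
        + Fintype.card H * (Fintype.card V * Fintype.card H) := by
    intro a ha
    rw [← card_filter_lt_load ha, mul_assoc, ← nsmul_eq_mul, ← Finset.sum_const]
    have h2 : ∑ h ∈ Finset.univ.filter (fun h => k < load a (a h)),
        (loadCount a j : ℝ) * defect k j a
        ≤ ∑ h ∈ Finset.univ.filter (fun h => k < load a (a h)),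
        (((Finset.univ.filter fun v => loadOff a h v = j).card : ℝ) * defect k j a
          + Fintype.card V * Fintype.card H) := by
      refine Finset.sum_le_sum fun h _ => ?_
      have h3 := abs_card_loadOff_sub_le a h j
      have h4 := abs_defect_le k j a
      have h5 : |(((Finset.univ.filter fun v => loadOff a h v = j).card : ℝ) - loadCount a j)
          * defect k j a| ≤ 1 * (Fintype.card V * Fintype.card H) := by
        rw [abs_mul]; gcongr
      have := (abs_le.1 h5).1
      linarith
    refine h2.trans ?_
    rw [Finset.sum_add_distrib, Finset.sum_const, nsmul_eq_mul]
    gcongr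
    exact Finset.card_le_univ _
  have hfr : ∀ a : H → V, ∑ h ∈ Finset.univ.filter (fun h => load a (a h) = j + 1),
        ∑ u, defect k j (Function.update a h u)
      ≤ Fintype.card V * ((j + 1 : ℕ) * loadCount a (j + 1)) * defect k j a
        + Fintype.card H * (Fintype.card V * D) := by
    intro a
    have h1 : ∀ h, ∑ u, defect k j (Function.update a h u)
        ≤ Fintype.card V * defect k j a + Fintype.card V * D := by
      intro h
      calc ∑ u, defect k j (Function.update a h u) ≤ ∑ _u : V, (defect k j a + D) := by
            refine Finset.sum_le_sum fun u _ => ?_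
            have := (abs_le.1 (abs_defect_update_sub_le k j a h u)).2
            linarith
        _ = _ := by rw [Finset.sum_const, nsmul_eq_mul, Finset.card_univ]; ring
    refine (Finset.sum_le_sum fun h _ => h1 h).trans ?_
    rw [Finset.sum_const, nsmul_eq_mul, mul_add]
    have h2 : ((Finset.univ.filter fun h => load a (a h) = j + 1).card : ℝ)
        = (j + 1 : ℕ) * loadCount a (j + 1) := by
      rw [card_filter_load_comp]; push_cast; ring
    have h3 : ((Finset.univ.filter fun h => load a (a h) = j + 1).card : ℝ) ≤ Fintype.card H := by
      exact_mod_cast Finset.card_le_univ _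
    have hD0 : 0 ≤ D := by positivity
    have h4 : ((Finset.univ.filter fun h => load a (a h) = j + 1).card : ℝ)
        * (Fintype.card V * D) ≤ Fintype.card H * (Fintype.card V * D) := by gcongr
    rw [h2] at h4 ⊢
    linarith
  have e : ∀ a : H → V, defect k j a ^ 2
      = (Fintype.card H - k * loadCount a k) * loadCount a j * defect k j a
        - Fintype.card V * ((j + 1 : ℕ) * loadCount a (j + 1)) * defect k j a := by
    intro a; rw [sq]; nth_rewrite 1 [defect]; ring
  simp only [e, Finset.sum_sub_distrib]
  have s1 := Finset.sum_le_sum hfl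
  have s2 := Finset.sum_le_sum fun a (_ : a ∈ allocFinset H V k) => hfr a
  rw [Finset.sum_add_distrib, Finset.sum_const, nsmul_eq_mul] at s1 s2
  have : ((allocFinset H V k).card : ℝ) * (Fintype.card V * Fintype.card H *
        (3 * Fintype.card H + 2 * (k + j + 1) * Fintype.card V))
      = (allocFinset H V k).card * (Fintype.card H * (Fintype.card V * Fintype.card H))
        + (allocFinset H V k).card * (Fintype.card H * (Fintype.card V * D)) := by
    rw [hD]; ring
  rw [this]
  linarith

/-- Concentration of the balance equation. -/
theorem card_filter_defect_le {k j : ℕ} (hj : k ≤ j) {C η : ℝ} (hη : 0 < η) (hV : 0 < Fintype.card V)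
    (hC : (Fintype.card H : ℝ) ≤ C * Fintype.card V) :
    (((allocFinset H V k).filter fun a => η * (Fintype.card V : ℝ) ^ 2 < -defect k j a).card : ℝ)
      ≤ C * (3 * C + 2 * (k + j + 1)) / η ^ 2 / Fintype.card V * (allocFinset H V k).card := by
  set n : ℝ := (Fintype.card V : ℝ) with hn
  have hn0 : 0 < n := Nat.cast_pos.2 hV
  -- Chebyshev's inequality.
  have h1 : (((allocFinset H V k).filter fun a => η * n ^ 2 < -defect k j a).card : ℝ)
      * (η * n ^ 2) ^ 2 ≤ ∑ a ∈ allocFinset H V k, defect k j a ^ 2 := by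
    rw [← nsmul_eq_mul, ← Finset.sum_const]
    refine (Finset.sum_le_sum fun a ha => ?_).trans
      (Finset.sum_le_sum_of_subset_of_nonneg (Finset.filter_subset _ _) fun _ _ _ => sq_nonneg _)
    have := (Finset.mem_filter.1 ha).2
    rw [← neg_sq (defect k j a)]
    gcongr
  have h2 := h1.trans (sum_sq_defect_le hj)
  rw [← hn] at h2
  have hC0 : 0 ≤ C := by
    by_contra hneg
    have : C * n < 0 := mul_neg_of_neg_of_pos (by linarith) hn0
    have : (0 : ℝ) ≤ Fintype.card H := by positivity
    linarith
  have h3 : n * Fintype.card H * (3 * Fintype.card H + 2 * (k + j + 1) * n)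
      ≤ n * (C * n) * (3 * (C * n) + 2 * (k + j + 1) * n) := by gcongr
  have h4 := h2.trans (mul_le_mul_of_nonneg_left h3 (Nat.cast_nonneg (allocFinset H V k).card))
  rw [← le_div_iff₀ (by positivity)] at h4
  refine h4.trans (le_of_eq ?_)
  field_simp

end Switching

/-! ### Truncated exponentials, the minimiser of `h_k` and supercriticality -/

section Analysis

theorem hasSum_f (j : ℕ) (x : ℝ) :
    HasSum (fun i : ℕ => x ^ (i + j) / ((i + j).factorial : ℝ)) (f j x) := by
  have h : HasSum (fun i : ℕ => x ^ i / (i.factorial : ℝ)) (Real.exp x) := by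
    rw [Real.exp_eq_exp_ℝ]; exact NormedSpace.expSeries_div_hasSum_exp x
  exact (hasSum_nat_add_iff' j).2 h

theorem f_eq_add (j : ℕ) (x : ℝ) : f j x = f (j + 1) x + x ^ j / (j.factorial : ℝ) := by
  simp only [f, Finset.sum_range_succ]; ring

theorem sum_le_f (j J : ℕ) {x : ℝ} (hx : 0 ≤ x) :
    ∑ i ∈ Finset.range J, x ^ (i + j) / ((i + j).factorial : ℝ) ≤ f j x :=
  sum_le_hasSum _ (fun i _ => by positivity) (hasSum_f j x)

theorem f_pos (j : ℕ) {x : ℝ} (hx : 0 < x) : 0 < f j x := by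
  have := sum_le_f j 1 hx.le
  simp only [Finset.sum_range_one, zero_add] at this
  exact lt_of_lt_of_le (by positivity) this

theorem hasDerivAt_f (j : ℕ) (x : ℝ) : HasDerivAt (f (j + 1)) (f j x) x := by
  have h1 : ∀ i : ℕ, HasDerivAt (fun x : ℝ => x ^ (i + 1) / ((i + 1).factorial : ℝ))
      (x ^ i / (i.factorial : ℝ)) x := by
    intro i
    have h := (hasDerivAt_pow (i + 1) x).div_const ((i + 1).factorial : ℝ)
    refine h.congr_deriv ?_
    rw [Nat.factorial_succ]; push_cast
    have : ((i : ℝ) + 1) ≠ 0 := by positivity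
    have : (i.factorial : ℝ) ≠ 0 := by positivity
    field_simp
  have h2 : HasDerivAt (fun x : ℝ => ∑ i ∈ Finset.range j, x ^ (i + 1) / ((i + 1).factorial : ℝ))
      (∑ i ∈ Finset.range j, x ^ i / (i.factorial : ℝ)) x :=
    HasDerivAt.fun_sum fun i _ => h1 i
  have h3 := (Real.hasDerivAt_exp x).sub (h2.add_const 1)
  refine h3.congr_of_eventuallyEq (Eventually.of_forall fun y => ?_)
  simp [f, Finset.sum_range_succ']

theorem continuous_f (j : ℕ) : Continuous (f j) := by
  unfold f; fun_prop

/-- `f_j(x) / x ^ j` is strictly increasing. -/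
theorem f_mul_pow_lt (j : ℕ) {x y : ℝ} (hx : 0 < x) (hxy : x < y) :
    f j x * y ^ j < f j y * x ^ j := by
  have hy := hx.trans hxy
  refine hasSum_lt (i := 1) (fun i => ?_) ?_ ((hasSum_f j x).mul_right _)
    ((hasSum_f j y).mul_right _)
  · have : x ^ i ≤ y ^ i := by gcongr
    calc x ^ (i + j) / ((i + j).factorial : ℝ) * y ^ j
        = x ^ i * (x ^ j * y ^ j / ((i + j).factorial : ℝ)) := by rw [pow_add]; ring
      _ ≤ y ^ i * (x ^ j * y ^ j / ((i + j).factorial : ℝ)) := by gcongr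
      _ = _ := by rw [pow_add]; ring
  · calc x ^ (1 + j) / ((1 + j).factorial : ℝ) * y ^ j
        = x * (x ^ j * y ^ j / ((1 + j).factorial : ℝ)) := by rw [pow_add]; ring
      _ < y * (x ^ j * y ^ j / ((1 + j).factorial : ℝ)) := by gcongr
      _ = _ := by rw [pow_add]; ring

/-- The mean `x f_j(x) / f_{j+1}(x)` of the truncated Poisson distribution is increasing. -/
theorem mean_mono (j : ℕ) {x y : ℝ} (hx : 0 < x) (hxy : x ≤ y) :
    x * f j x / f (j + 1) x ≤ y * f j y / f (j + 1) y := by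
  have hy := hx.trans_le hxy
  rw [div_le_div_iff₀ (f_pos _ hx) (f_pos _ hy)]
  set T : ℝ → ℕ → ℝ := fun x i => x ^ (i + (j + 1)) / ((i + (j + 1)).factorial : ℝ) with hT
  have hD : ∀ x : ℝ, HasSum (fun i : ℕ => ((i : ℝ) + (j + 1)) * T x i) (x * f j x) := by
    intro x
    refine ((hasSum_f j x).mul_left x).congr_fun ?_
    intro i
    simp only [hT]
    rw [show i + (j + 1) = i + j + 1 by omega, Nat.factorial_succ, pow_succ]
    push_cast
    have : ((i : ℝ) + j + 1) ≠ 0 := by positivity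
    have : ((i + j).factorial : ℝ) ≠ 0 := by positivity
    field_simp
    ring
  have hP : ∀ x : ℝ, HasSum (T x) (f (j + 1) x) := fun x => hasSum_f (j + 1) x
  refine le_of_tendsto_of_tendsto' ((hD x).tendsto_sum_nat.mul (hP y).tendsto_sum_nat)
    ((hD y).tendsto_sum_nat.mul (hP x).tendsto_sum_nat) fun N => ?_
  rw [Finset.sum_mul_sum, Finset.sum_mul_sum]
  -- Chebyshev's sum inequality for the partial sums: after symmetrising in `i` and `l`, each term
  -- has the sign of `(i - l) (x ^ i y ^ l - x ^ l y ^ i) ≤ 0`.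
  have key : ∑ i ∈ Finset.range N, ∑ l ∈ Finset.range N, ((i : ℝ) + (j + 1)) * T x i * T y l
      - ∑ i ∈ Finset.range N, ∑ l ∈ Finset.range N, ((i : ℝ) + (j + 1)) * T y i * T x l
      = ∑ i ∈ Finset.range N, ∑ l ∈ Finset.range N,
        ((i : ℝ) - l) * (T x i * T y l) := by
    rw [Finset.sum_comm (f := fun (i l : ℕ) => ((i : ℝ) + (j + 1)) * T y i * T x l)]
    simp only [← Finset.sum_sub_distrib]
    exact Finset.sum_congr rfl fun i _ => Finset.sum_congr rfl fun l _ => by ring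
  have key2 : (∑ i ∈ Finset.range N, ∑ l ∈ Finset.range N, ((i : ℝ) - l) * (T x i * T y l))
      + ∑ i ∈ Finset.range N, ∑ l ∈ Finset.range N, ((i : ℝ) - l) * (T x i * T y l) ≤ 0 := by
    nth_rewrite 2 [Finset.sum_comm]
    simp only [← Finset.sum_add_distrib]
    refine Finset.sum_nonpos fun i _ => Finset.sum_nonpos fun l _ => ?_
    have e : ((i : ℝ) - l) * (T x i * T y l) + ((l : ℝ) - i) * (T x l * T y i)
        = ((i : ℝ) - l) * (x ^ i * y ^ l - x ^ l * y ^ i) * (x ^ (j + 1) * y ^ (j + 1) /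
          (((i + (j + 1)).factorial : ℝ) * ((l + (j + 1)).factorial : ℝ))) := by
      simp only [hT, pow_add]; ring
    rw [e]
    refine mul_nonpos_of_nonpos_of_nonneg ?_ (by positivity)
    have hp : ∀ a b : ℕ, a ≤ b → x ^ b * y ^ a ≤ x ^ a * y ^ b := by
      intro a b hab
      obtain ⟨d, rfl⟩ := Nat.exists_eq_add_of_le hab
      calc x ^ (a + d) * y ^ a = x ^ a * y ^ a * x ^ d := by rw [pow_add]; ring
        _ ≤ x ^ a * y ^ a * y ^ d := by gcongr
        _ = _ := by rw [pow_add]; ring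
    rcases le_total i l with h | h
    · have h1 : (i : ℝ) ≤ l := by exact_mod_cast h
      exact mul_nonpos_of_nonpos_of_nonneg (by linarith) (by linarith [hp i l h])
    · have h1 : (l : ℝ) ≤ i := by exact_mod_cast h
      exact mul_nonpos_of_nonneg_of_nonpos (by linarith) (by linarith [hp l i h])
  linarith

/-- The critical point of `h_k`. -/
theorem exists_critical {j : ℕ} (hj : 2 ≤ j) :
    ∃ μ : ℝ, 0 < μ ∧ f j μ * ((j - 1).factorial : ℝ) = μ ^ j := by
  have hc : ContinuousOn (fun x => f j x * ((j - 1).factorial : ℝ) - x ^ j)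
      (Set.Icc (1 / 2) (j * (j + 1))) :=
    (((continuous_f j).mul continuous_const).sub (continuous_pow j)).continuousOn
  have hfac : (j.factorial : ℝ) = j * (j - 1).factorial := by
    rw [← Nat.mul_factorial_pred (by omega : j ≠ 0)]; push_cast; ring
  have hj' : (2 : ℝ) ≤ j := by exact_mod_cast hj
  -- At `1 / 2` the bound `f_j(x) ≤ e ^ x x ^ j / j!` suffices, since `e ^ (1 / 2) ≤ 2 ≤ j`.
  have h1 : f j (1 / 2) * ((j - 1).factorial : ℝ) - (1 / 2) ^ j ≤ 0 := by
    have hle : f j (1 / 2) ≤ Real.exp (1 / 2) * ((1 / 2) ^ j / (j.factorial : ℝ)) := by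
      have he : HasSum (fun i : ℕ => (1 / 2 : ℝ) ^ i / (i.factorial : ℝ)) (Real.exp (1 / 2)) := by
        rw [Real.exp_eq_exp_ℝ]; exact NormedSpace.expSeries_div_hasSum_exp _
      refine hasSum_le (fun i => ?_) (hasSum_f j (1 / 2))
        (he.mul_right ((1 / 2) ^ j / (j.factorial : ℝ)))
      rw [pow_add, div_mul_div_comm]
      gcongr
      exact_mod_cast Nat.le_of_dvd (Nat.factorial_pos _) (Nat.factorial_mul_factorial_dvd_factorial_add i j)
    have hexp : Real.exp (1 / 2) ≤ 2 := by
      have h4 : Real.exp (1 / 2) ^ 2 ≤ 2 ^ 2 := by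
        rw [← Real.exp_nat_mul]
        norm_num
        linarith [Real.exp_one_lt_d9]
      exact le_of_sq_le_sq h4 (by norm_num)
    have h3 : f j (1 / 2) * ((j - 1).factorial : ℝ) ≤
        2 * ((1 / 2) ^ j / (j.factorial : ℝ)) * ((j - 1).factorial : ℝ) := by
      gcongr
      exact hle.trans (by gcongr)
    have h5 : 2 * ((1 / 2 : ℝ) ^ j / (j.factorial : ℝ)) * ((j - 1).factorial : ℝ)
        = (1 / 2) ^ j * (2 / j) := by
      rw [hfac]; field_simp
    have h6 : (1 / 2 : ℝ) ^ j * (2 / j) ≤ (1 / 2) ^ j * 1 := by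
      gcongr; rw [div_le_one (by linarith)]; exact hj'
    linarith
  -- At `y = j (j + 1)` the single term `y ^ (j + 1) / (j + 1)!` already gives `y ^ j`.
  have h2 : 0 ≤ f j (j * (j + 1)) * ((j - 1).factorial : ℝ) - ((j : ℝ) * (j + 1)) ^ j := by
    set y : ℝ := (j : ℝ) * (j + 1) with hy
    have hy0 : 0 < y := by positivity
    have h := sum_le_f j 2 hy0.le
    rw [Finset.sum_range_succ, Finset.sum_range_one] at h
    have hp : 0 ≤ y ^ (0 + j) / ((0 + j).factorial : ℝ) := by positivity
    have h3 : y ^ (1 + j) / ((1 + j).factorial : ℝ) * ((j - 1).factorial : ℝ) ≤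
        f j y * ((j - 1).factorial : ℝ) := by gcongr; linarith
    have h4 : y ^ (1 + j) / ((1 + j).factorial : ℝ) * ((j - 1).factorial : ℝ) = y ^ j := by
      rw [add_comm 1 j, Nat.factorial_succ, pow_succ]
      push_cast
      rw [hfac]
      nth_rewrite 2 [hy]
      field_simp
    linarith
  have hle : (1 / 2 : ℝ) ≤ j * (j + 1) := by nlinarith
  obtain ⟨μ, hμ, h0⟩ := intermediate_value_Icc hle hc ⟨h1, h2⟩
  exact ⟨μ, lt_of_lt_of_le (by norm_num) hμ.1, by simpa [sub_eq_zero] using h0⟩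

theorem hasDerivAt_hFun {k : ℕ} (hk : 3 ≤ k) {x : ℝ} (hx : 0 < x) :
    HasDerivAt (hFun k) (Real.exp x * (f (k - 1) x - x ^ (k - 1) / ((k - 2).factorial : ℝ))
      / f (k - 1) x ^ 2) x := by
  obtain ⟨j, rfl⟩ : ∃ j, k = j + 2 := ⟨k - 2, by omega⟩
  simp only [show j + 2 - 1 = j + 1 from rfl, Nat.add_sub_cancel]
  have h := ((Real.hasDerivAt_exp x).mul (hasDerivAt_id x)).div (hasDerivAt_f j x)
    (f_pos (j + 1) hx).ne'
  have h' : HasDerivAt (hFun (j + 2)) _ x := h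
  convert h' using 1
  simp only [id, Pi.mul_apply]
  rw [f_eq_add j x]
  ring

/-- The derivative of `h_k` has the sign of `f_{k-1}(x) / x ^ (k-1) - 1 / (k-2)!`, which is strictly
increasing in `x`. So `h_k` has a single minimiser, characterised by the vanishing of this
expression. -/
theorem muCore_spec {k : ℕ} (hk : 3 ≤ k) :
    0 < muCore k ∧ f (k - 1) (muCore k) * ((k - 2).factorial : ℝ) = muCore k ^ (k - 1) := by
  obtain ⟨μ, hμ, hcrit⟩ := exists_critical (j := k - 1) (by omega)
  rw [show k - 1 - 1 = k - 2 by omega] at hcrit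
  have hfac : (0 : ℝ) < (k - 2).factorial := by positivity
  have hlt : ∀ x, 0 < x → x < μ → f (k - 1) x - x ^ (k - 1) / ((k - 2).factorial : ℝ) < 0 := by
    intro x hx hxμ
    have h := f_mul_pow_lt (k - 1) hx hxμ
    rw [← hcrit] at h
    have hf := f_pos (k - 1) hμ
    rw [sub_neg, lt_div_iff₀ hfac]
    have : f (k - 1) μ * (f (k - 1) x * ((k - 2).factorial : ℝ)) < f (k - 1) μ * x ^ (k - 1) := by
      linarith
    exact lt_of_mul_lt_mul_left this hf.le
  have hgt : ∀ x, μ < x → 0 < f (k - 1) x - x ^ (k - 1) / ((k - 2).factorial : ℝ) := by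
    intro x hxμ
    have h := f_mul_pow_lt (k - 1) hμ hxμ
    rw [← hcrit] at h
    have hf := f_pos (k - 1) hμ
    rw [sub_pos, div_lt_iff₀ hfac]
    have : f (k - 1) μ * x ^ (k - 1) < f (k - 1) μ * (f (k - 1) x * ((k - 2).factorial : ℝ)) := by
      linarith
    exact lt_of_mul_lt_mul_left this hf.le
  have hcont : ContinuousOn (hFun k) (Set.Ioi 0) := fun x hx =>
    (hasDerivAt_hFun hk hx).continuousAt.continuousWithinAt
  have hanti : StrictAntiOn (hFun k) (Set.Ioc 0 μ) := by
    refine strictAntiOn_of_deriv_neg (convex_Ioc 0 μ) (hcont.mono fun x hx => hx.1) ?_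
    intro x hx
    rw [interior_Ioc] at hx
    rw [(hasDerivAt_hFun hk hx.1).deriv]
    have hf := f_pos (k - 1) hx.1
    exact div_neg_of_neg_of_pos
      (mul_neg_of_pos_of_neg (Real.exp_pos x) (hlt x hx.1 hx.2)) (by positivity)
  have hmono : StrictMonoOn (hFun k) (Set.Ici μ) := by
    refine strictMonoOn_of_deriv_pos (convex_Ici μ) (hcont.mono fun x hx => hμ.trans_le hx) ?_
    intro x hx
    rw [interior_Ici] at hx
    have hx0 : 0 < x := hμ.trans hx
    rw [(hasDerivAt_hFun hk hx0).deriv]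
    have hf := f_pos (k - 1) hx0
    exact div_pos (mul_pos (Real.exp_pos x) (hgt x hx)) (by positivity)
  have hmin : ∀ x, 0 < x → x ≠ μ → hFun k μ < hFun k x := by
    intro x hx hne
    rcases lt_or_gt_of_ne hne with h | h
    · exact hanti ⟨hx, h.le⟩ ⟨hμ, le_rfl⟩ h
    · exact hmono (Set.mem_Ici.2 le_rfl) (Set.mem_Ici.2 h.le) h
  have hc : cCore k = hFun k μ := by
    refine IsLeast.csInf_eq ⟨⟨μ, hμ, rfl⟩, ?_⟩
    rintro _ ⟨x, hx, rfl⟩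
    rcases eq_or_ne x μ with rfl | hne
    · exact le_rfl
    · exact (hmin x hx hne).le
  have hset : {x : ℝ | 0 < x ∧ hFun k x = cCore k} = {μ} := by
    ext x
    simp only [Set.mem_ofPred_eq, Set.mem_singleton_iff, hc]
    constructor
    · rintro ⟨hx, h⟩
      by_contra hne
      exact (hmin x hx hne).ne' h
    · rintro rfl; exact ⟨hμ, rfl⟩
  have : muCore k = μ := by rw [muCore, hset, csSup_singleton]
  rw [this]
  exact ⟨hμ, hcrit⟩

theorem mul_f_eq_add (j : ℕ) (L : ℝ) : L * f (j + 1) L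
    = L * f (j + 2) L + L ^ (j + 2) / ((j + 1).factorial : ℝ) := by
  rw [f_eq_add (j + 1) L]; ring

/-- Here `k = j + 2`, and `Y` and `L` are the numbers, per vertex, of points at vertices of load `k`
and of larger load. The average load `L + Y` is then almost at least the truncated Poisson mean with
parameter `L`. -/
theorem mul_mean_le_of_balance {j : ℕ} {L Y η : ℝ} (hL : 0 < L) (hη : 0 ≤ η)
    (h : (1 - η) * (L ^ (j + 2) / ((j + 1).factorial : ℝ)) ≤ Y * f (j + 2) L) :
    (1 - η) * (L * f (j + 1) L / f (j + 2) L) ≤ L + Y := by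
  have hf := f_pos (j + 2) hL
  rw [← mul_div_assoc, div_le_iff₀ hf, mul_f_eq_add]
  have : 0 ≤ η * (L * f (j + 2) L) := by positivity
  linarith

/-- With equality in `h` and `η = 0`, the light proportion `Y / (L + Y)` is `L ^ (j+1) / ((j+1)!
f_{j+1}(L))`, which `hB` bounds below by `B / (j + 1)`, where `j + 1 = k - 1`. -/
theorem mul_add_le_of_balance {j : ℕ} {L Y η q B : ℝ} (hL : 0 < L) (hq : 0 ≤ q) (hq1 : q ≤ 1)
    (hη : 0 ≤ η) (hη1 : η ≤ 1) (hqB : q * (j + 1) ≤ (1 - η) * B)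
    (hB : B * (j.factorial * f (j + 1) L) ≤ L ^ (j + 1))
    (h : (1 - η) * (L ^ (j + 2) / ((j + 1).factorial : ℝ)) ≤ Y * f (j + 2) L) :
    q * (L + Y) ≤ Y := by
  have hf := f_pos (j + 2) hL
  have hf1 := f_pos (j + 1) hL
  have hfac : (0 : ℝ) < (j + 1).factorial := by positivity
  have hA : q * (((j + 1).factorial : ℝ) * f (j + 1) L) ≤ (1 - η) * L ^ (j + 1) := by
    calc q * (((j + 1).factorial : ℝ) * f (j + 1) L)
        = q * (j + 1) * (j.factorial * f (j + 1) L) := by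
          rw [Nat.factorial_succ]; push_cast; ring
      _ ≤ (1 - η) * B * (j.factorial * f (j + 1) L) := by gcongr
      _ ≤ (1 - η) * L ^ (j + 1) := by
          rw [mul_assoc]; exact mul_le_mul_of_nonneg_left hB (by linarith)
  set p := L ^ (j + 2) / ((j + 1).factorial : ℝ) with hp
  have hp0 : 0 < p := by positivity
  have hA' : q * (L * f (j + 2) L + p) ≤ (1 - η) * p := by
    rw [← mul_f_eq_add, hp, ← mul_div_assoc, le_div_iff₀ hfac]
    have := mul_le_mul_of_nonneg_right hA hL.le
    calc q * (L * f (j + 1) L) * ((j + 1).factorial : ℝ)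
        = q * (((j + 1).factorial : ℝ) * f (j + 1) L) * L := by ring
      _ ≤ (1 - η) * L ^ (j + 1) * L := this
      _ = (1 - η) * L ^ (j + 2) := by ring
  have hfin : q * L * f (j + 2) L ≤ (1 - q) * Y * f (j + 2) L := by
    have h1 : (1 - q) * ((1 - η) * p) ≤ (1 - q) * (Y * f (j + 2) L) :=
      mul_le_mul_of_nonneg_left h (by linarith)
    have h2 : 0 ≤ q * (η * p) := by positivity
    linarith
  have := le_of_mul_le_mul_right hfin hf
  linarith

/-- Below `c'_k` the balance equation of the truncated Poisson distribution, if it holds up to a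
small relative error, makes the deletion process supercritical. -/
theorem exists_supercritical {k : ℕ} (hk : 3 ≤ k) {ε : ℝ} (hε : 0 < ε) :
    ∃ q : ℝ, 0 < q ∧ q ≤ 1 ∧ 1 < q * (k - 1) ∧ ∃ η : ℝ, 0 < η ∧ η < 1 ∧ ∀ c X : ℝ,
      0 ≤ c → c ≤ cPrime k - ε → k * X ≤ c →
      (0 < c - k * X → (1 - η) * (c - k * X) ^ k ≤ X * k.factorial * f k (c - k * X)) →
      q * c ≤ k * X := by
  obtain ⟨hμ, hcrit⟩ := muCore_spec hk
  set μ := muCore k with hμdef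
  obtain ⟨j, rfl⟩ : ∃ j, k = j + 2 := ⟨k - 2, by omega⟩
  simp only [show j + 2 - 1 = j + 1 from rfl, Nat.add_sub_cancel] at hcrit
  set g : ℝ → ℝ := fun x => x * f (j + 1) x / f (j + 2) x with hg
  have hG : cPrime (j + 2) = g μ := rfl
  have hGpos : 0 < g μ := div_pos (mul_pos hμ (f_pos _ hμ)) (f_pos _ hμ)
  have hgc : ContinuousAt g μ :=
    (continuousAt_id.mul (continuous_f _).continuousAt).div (continuous_f _).continuousAt
      (f_pos _ hμ).ne'
  -- Half of `ε` separates `lam` from the critical parameter; the other half absorbs the error `η`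
  -- in the balance.
  obtain ⟨lam, hlam0, hlamμ, hglam⟩ : ∃ lam, 0 < lam ∧ lam < μ ∧ g μ - ε / 2 < g lam := by
    have h1 : ∀ᶠ x in 𝓝[<] μ, g μ - ε / 2 < g x :=
      (hgc.tendsto.mono_left nhdsWithin_le_nhds).eventually (lt_mem_nhds (by linarith))
    have h2 : ∀ᶠ x in 𝓝[<] μ, x ∈ Set.Ioo 0 μ := Ioo_mem_nhdsLT hμ
    obtain ⟨x, hx1, hx2⟩ := (h1.and h2).exists
    exact ⟨x, hx2.1, hx2.2, hx1⟩
  have hflam := f_pos (j + 1) hlam0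
  have hfac : (0 : ℝ) < j.factorial := by positivity
  -- `B` is the mean offspring number `(k - 1) ·` (light proportion) at `lam`. It equals `1` at `μ`
  -- and decreases in the parameter.
  set B := lam ^ (j + 1) / (j.factorial * f (j + 1) lam) with hB
  have hB1 : 1 < B := by
    rw [hB, one_lt_div (by positivity)]
    have h := f_mul_pow_lt (j + 1) hlam0 hlamμ
    rw [← hcrit] at h
    have hf := f_pos (j + 1) hμ
    have : f (j + 1) μ * (j.factorial * f (j + 1) lam) < f (j + 1) μ * lam ^ (j + 1) := by linarith
    exact lt_of_mul_lt_mul_left this hf.le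
  have hB0 : 0 < B := by linarith
  have hj1 : (0 : ℝ) < (j : ℝ) + 1 := by positivity
  set η := min (min (ε / (2 * g μ)) (1 / 2)) ((B - 1) / (2 * B)) with hη
  have hη0 : 0 < η := by
    refine lt_min (lt_min ?_ (by norm_num)) ?_
    · positivity
    · exact div_pos (by linarith) (by linarith)
  have hη1 : η ≤ ε / (2 * g μ) := (min_le_left _ _).trans (min_le_left _ _)
  have hη2 : η ≤ 1 / 2 := (min_le_left _ _).trans (min_le_right _ _)
  have hη3 : η ≤ (B - 1) / (2 * B) := min_le_right _ _
  have hηB : (B + 1) / 2 ≤ (1 - η) * B := by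
    have : η * B ≤ (B - 1) / (2 * B) * B := by gcongr
    have e : (B - 1) / (2 * B) * B = (B - 1) / 2 := by field_simp
    linarith
  refine ⟨min 1 ((B + 1) / 2 / (j + 1)), lt_min one_pos (by positivity), min_le_left _ _, ?_,
    η, hη0, by linarith, ?_⟩
  · push_cast
    have hj : (1 : ℝ) ≤ j := by exact_mod_cast (by omega : 1 ≤ j)
    rw [show (j : ℝ) + 2 - 1 = j + 1 by ring, min_mul_of_nonneg _ _ hj1.le]
    refine lt_min (by linarith) ?_
    rw [div_mul_cancel₀ _ hj1.ne']; linarith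
  intro c X hc0 hc hX hbal
  set q := min 1 ((B + 1) / 2 / ((j : ℝ) + 1)) with hq
  have hq1 : q ≤ 1 := min_le_left _ _
  have hq2 : q ≤ (B + 1) / 2 / ((j : ℝ) + 1) := min_le_right _ _
  have hq0 : 0 < q := lt_min one_pos (by positivity)
  set L := c - ((j + 2 : ℕ) : ℝ) * X with hL
  rcases eq_or_lt_of_le (show 0 ≤ L by linarith) with h0 | h0
  · have : c = ((j + 2 : ℕ) : ℝ) * X := by linarith
    rw [← this]; nlinarith
  have hb := hbal h0
  set Y := ((j + 2 : ℕ) : ℝ) * X with hY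
  have hcY : c = L + Y := by linarith
  have hfac1 : (0 : ℝ) < (j + 1).factorial := by positivity
  have hYp : (1 - η) * (L ^ (j + 2) / ((j + 1).factorial : ℝ)) ≤ Y * f (j + 2) L := by
    have e : X * ((j + 2).factorial : ℝ) * f (j + 2) L
        = Y * f (j + 2) L * ((j + 1).factorial : ℝ) := by
      rw [Nat.factorial_succ (j + 1), hY]; push_cast; ring
    rw [e] at hb
    rw [← mul_div_assoc, div_le_iff₀ hfac1]
    exact hb
  -- The mean `g` is monotone, so this places `L` below `lam`, where the offspring number is at
  -- least `B`.
  have hgL : g L < g lam := by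
    have h2 : (1 - η) * g L ≤ c := hcY ▸ mul_mean_le_of_balance h0 hη0.le hYp
    have h4 : η * g μ ≤ ε / 2 := by
      calc η * g μ ≤ ε / (2 * g μ) * g μ := mul_le_mul_of_nonneg_right hη1 hGpos.le
        _ = ε / 2 := by field_simp
    have h7 : 0 ≤ η * ε := by positivity
    have h5 : (1 - η) * g L ≤ (1 - η) * (g μ - ε / 2) := by linarith
    have h6 := le_of_mul_le_mul_left h5 (by linarith)
    linarith
  have hLlam : L < lam := by
    by_contra hcon
    exact absurd (mean_mono (j + 1) hlam0 (not_lt.1 hcon)) (not_le.2 hgL)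
  have hBL : B * (j.factorial * f (j + 1) L) ≤ L ^ (j + 1) := by
    have h := f_mul_pow_lt (j + 1) h0 hLlam
    rw [hB, div_mul_eq_mul_div, div_le_iff₀ (by positivity)]
    have := mul_le_mul_of_nonneg_left h.le hfac.le
    linarith
  rw [hcY]
  refine mul_add_le_of_balance h0 hq0.le hq1 hη0.le (by linarith) ?_ hBL hYp
  refine le_trans ?_ hηB
  rwa [← le_div_iff₀ hj1]

end Analysis

/-! ### From the balance equations to the number of vertices of load `k` -/

section Concentration

set_option linter.unusedSectionVars false

/-- Approximate solutions of the balance equations are close to Poisson. -/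
theorem le_poisson_of_balance {k J : ℕ} {L C η : ℝ} (hL : 0 ≤ L) (hLC : L ≤ C) (hη : 0 ≤ η)
    {x : ℕ → ℝ} (hx : ∀ i < J, ((k + i + 1 : ℕ) : ℝ) * x (i + 1) ≤ L * x i + η) :
    ∀ i ≤ J, x i ≤ x 0 * (L ^ i * k.factorial / (k + i).factorial)
      + η * ∑ l ∈ Finset.range i, C ^ l := by
  intro i
  induction i with
  | zero =>
    intro _
    have : (k.factorial : ℝ) ≠ 0 := by positivity
    simp [this]
  | succ i ih =>
    intro hi
    have h1 := ih (by omega)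
    have h2 := hx i (by omega)
    have hpos : (0 : ℝ) < ((k + i + 1 : ℕ) : ℝ) := by positivity
    have hone : (1 : ℝ) ≤ ((k + i + 1 : ℕ) : ℝ) := by exact_mod_cast (by omega : 1 ≤ k + i + 1)
    have hC : 0 ≤ C := hL.trans hLC
    have h3 : x (i + 1) ≤ (L * (x 0 * (L ^ i * k.factorial / (k + i).factorial)
        + η * ∑ l ∈ Finset.range i, C ^ l) + η) / ((k + i + 1 : ℕ) : ℝ) := by
      rw [le_div_iff₀ hpos, mul_comm]
      exact h2.trans (by gcongr)
    have hS : (0 : ℝ) ≤ ∑ l ∈ Finset.range i, C ^ l := Finset.sum_nonneg fun _ _ => by positivity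
    have h4 : (L * (η * ∑ l ∈ Finset.range i, C ^ l) + η) / ((k + i + 1 : ℕ) : ℝ)
        ≤ η * ∑ l ∈ Finset.range (i + 1), C ^ l := by
      refine (div_le_self (by positivity) hone).trans ?_
      rw [geom_sum_succ]
      have : L * (η * ∑ l ∈ Finset.range i, C ^ l) ≤ C * (η * ∑ l ∈ Finset.range i, C ^ l) := by
        gcongr
      linarith
    have h5 : x 0 * (L ^ (i + 1) * k.factorial / (k + (i + 1)).factorial)
        = L * (x 0 * (L ^ i * k.factorial / (k + i).factorial)) / ((k + i + 1 : ℕ) : ℝ) := by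
      rw [← add_assoc, Nat.factorial_succ, pow_succ]
      push_cast
      field_simp
    rw [h5]
    refine h3.trans ?_
    rw [mul_add, add_assoc, add_div]
    linarith

variable {H V : Type*} [Fintype H] [DecidableEq H] [Fintype V] [DecidableEq V]

theorem sum_load (a : H → V) : ∑ v, load a v = Fintype.card H :=
  (Finset.card_eq_sum_card_fiberwise (s := Finset.univ) (t := Finset.univ) (f := a)
    (by simp)).symm

theorem card_le_sum_loadCount {k : ℕ} {a : H → V} (ha : a ∈ allocFinset H V k) (J : ℕ) :
    Fintype.card V ≤ ∑ i ∈ Finset.range J, loadCount a (k + i)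
      + (Finset.univ.filter fun v => k + J ≤ load a v).card := by
  simp only [allocFinset, Finset.mem_filter, Finset.mem_univ, true_and] at ha
  have h : (Finset.univ : Finset V) ⊆ ((Finset.range J).biUnion fun i =>
      Finset.univ.filter fun v => load a v = k + i)
      ∪ Finset.univ.filter fun v => k + J ≤ load a v := by
    intro v _
    simp only [Finset.mem_union, Finset.mem_biUnion, Finset.mem_range, Finset.mem_filter,
      Finset.mem_univ, true_and]
    have := ha v
    by_cases hv : k + J ≤ load a v
    · exact Or.inr hv
    · exact Or.inl ⟨load a v - k, by omega, by omega⟩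
  refine (Finset.card_le_card h).trans ((Finset.card_union_le _ _).trans ?_)
  gcongr
  exact Finset.card_biUnion_le

theorem mul_card_le_load (a : H → V) (l : ℕ) :
    l * (Finset.univ.filter fun v => l ≤ load a v).card ≤ Fintype.card H := by
  rw [← sum_load a, mul_comm, ← smul_eq_mul, ← Finset.sum_const]
  exact (Finset.sum_le_sum fun v hv => (Finset.mem_filter.1 hv).2).trans
    (Finset.sum_le_sum_of_subset (Finset.filter_subset _ _))

/-- If the balance equations hold approximately, then the number of vertices of load `k` is at least
about what the truncated Poisson distribution predicts. -/
theorem balance_of_defect_le {k J : ℕ} {C η δ : ℝ} (hη : 0 ≤ η) (hC : 0 ≤ C) (hV : 0 < Fintype.card V)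
    (hHV : (Fintype.card H : ℝ) ≤ C * Fintype.card V) (hδ : C < δ / 2 * (k + J : ℕ))
    (hJ : η * ∑ i ∈ Finset.range J, ∑ l ∈ Finset.range i, C ^ l ≤ δ / 2)
    {a : H → V} (ha : a ∈ allocFinset H V k)
    (hd : ∀ i < J, -defect k (k + i) a ≤ η * (Fintype.card V : ℝ) ^ 2)
    {c X : ℝ} (hc : c = Fintype.card H / Fintype.card V) (hX : X = loadCount a k / Fintype.card V)
    (hL : 0 < c - k * X) :
    (1 - δ) * (c - k * X) ^ k ≤ X * k.factorial * f k (c - k * X) := by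
  set n : ℝ := (Fintype.card V : ℝ) with hn
  have hn0 : 0 < n := Nat.cast_pos.2 hV
  set L := c - k * X with hLdef
  set x : ℕ → ℝ := fun i => loadCount a (k + i) / n with hx
  have hX0 : 0 ≤ X := by rw [hX]; positivity
  have hLC : L ≤ C := by
    have h1 : c ≤ C := by rw [hc, div_le_iff₀ hn0]; exact hHV
    have h2 : 0 ≤ k * X := by positivity
    linarith
  have hrec : ∀ i < J, ((k + i + 1 : ℕ) : ℝ) * x (i + 1) ≤ L * x i + η := by
    intro i hi
    have h := hd i hi
    rw [defect, ← hn] at h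
    have hcn : c * n = Fintype.card H := by rw [hc]; field_simp
    have hXn : X * n = loadCount a k := by rw [hX]; field_simp
    have hxn : ∀ i, x i * n = loadCount a (k + i) := by intro i; simp only [hx]; field_simp
    rw [← hcn, ← hXn, ← hxn i, add_assoc k i 1, ← hxn (i + 1), ← add_assoc k i 1] at h
    have h2 : n ^ 2 * (((k + i + 1 : ℕ) : ℝ) * x (i + 1)) ≤ n ^ 2 * (L * x i + η) := by
      rw [hLdef]
      linarith
    exact le_of_mul_le_mul_left h2 (by positivity)
  have hp := le_poisson_of_balance hL.le hLC hη hrec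
  -- Markov's inequality for the load.
  have htail : ((Finset.univ.filter fun v => k + J ≤ load a v).card : ℝ) ≤ δ / 2 * n := by
    have h1 : (((k + J) * (Finset.univ.filter fun v => k + J ≤ load a v).card : ℕ) : ℝ)
        ≤ Fintype.card H := by exact_mod_cast mul_card_le_load a (k + J)
    rw [Nat.cast_mul] at h1
    have hkJ : (0 : ℝ) ≤ ((k + J : ℕ) : ℝ) := by positivity
    rcases eq_or_lt_of_le hkJ with h0 | h0
    · rw [← h0] at hδ; linarith
    · have h2 : ((k + J : ℕ) : ℝ) * (Finset.univ.filter fun v => k + J ≤ load a v).card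
          ≤ ((k + J : ℕ) : ℝ) * (δ / 2 * n) := by
        have : C * n ≤ δ / 2 * (k + J : ℕ) * n := by gcongr
        linarith
      exact le_of_mul_le_mul_left h2 h0
  -- All loads are at least `k`, so the densities `x i` almost sum to `1`. As each is at most about
  -- a Poisson multiple of `x 0 = X`, this normalisation bounds `X` from below.
  have hsum : 1 - δ / 2 ≤ ∑ i ∈ Finset.range J, x i := by
    have h1 : n ≤ ∑ i ∈ Finset.range J, (loadCount a (k + i) : ℝ)
        + (Finset.univ.filter fun v => k + J ≤ load a v).card := by
      rw [hn]; exact_mod_cast card_le_sum_loadCount ha J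
    simp only [hx]
    rw [← Finset.sum_div, le_div_iff₀ hn0]
    linarith
  have hsum2 : ∑ i ∈ Finset.range J, x i
      ≤ X * ∑ i ∈ Finset.range J, (L ^ i * k.factorial / (k + i).factorial) + δ / 2 := by
    refine (Finset.sum_le_sum fun i hi => hp i (Finset.mem_range.1 hi).le).trans ?_
    rw [Finset.sum_add_distrib, ← Finset.mul_sum, ← Finset.mul_sum]
    have : x 0 = X := by simp only [hx, add_zero, hX]
    rw [this]
    linarith
  have hf : L ^ k * ∑ i ∈ Finset.range J, (L ^ i * k.factorial / (k + i).factorial)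
      ≤ k.factorial * f k L := by
    refine le_trans (le_of_eq ?_) (mul_le_mul_of_nonneg_left (sum_le_f k J hL.le)
      (Nat.cast_nonneg k.factorial))
    rw [Finset.mul_sum, Finset.mul_sum]
    refine Finset.sum_congr rfl fun i _ => ?_
    rw [add_comm k i, pow_add]; ring
  have hLk : 0 < L ^ k := by positivity
  calc (1 - δ) * L ^ k
      ≤ X * (∑ i ∈ Finset.range J, (L ^ i * k.factorial / (k + i).factorial)) * L ^ k := by
        gcongr; linarith
    _ = X * (L ^ k * ∑ i ∈ Finset.range J, (L ^ i * k.factorial / (k + i).factorial)) := by ring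
    _ ≤ X * (k.factorial * f k L) := by gcongr
    _ = _ := by ring

/-- In the supercritical range all but a proportion `O(1 / n)` of the allocations have more than the
critical number of points in vertices of load `k`. -/
theorem exists_card_filter_light_lt {k : ℕ} (hk : 3 ≤ k) {ε : ℝ} (hε : 0 < ε) :
    ∃ q : ℝ, 0 < q ∧ q ≤ 1 ∧ 1 < q * (k - 1) ∧ ∃ D : ℝ, 0 ≤ D ∧ ∀ n N : ℕ, 0 < n →
      (N : ℝ) / n ≤ cPrime k - ε →
      (((allocFinset (Fin N) (Fin n) k).filter fun a => (k * loadCount a k : ℝ) < q * N).card : ℝ)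
        ≤ D / n * (allocFinset (Fin N) (Fin n) k).card := by
  obtain ⟨q, hq0, hq1, hqk, δ, hδ0, hδ1, hq⟩ := exists_supercritical hk hε
  refine ⟨q, hq0, hq1, hqk, ?_⟩
  set C := max (cPrime k) 0 with hC
  have hC0 : 0 ≤ C := le_max_right _ _
  obtain ⟨J, hJ⟩ := exists_nat_gt (C / (δ / 2))
  have hδ : C < δ / 2 * (k + J : ℕ) := by
    rw [div_lt_iff₀ (by positivity)] at hJ
    push_cast
    have : (0 : ℝ) ≤ δ / 2 * k := by positivity
    linarith
  set S : ℝ := ∑ i ∈ Finset.range J, ∑ l ∈ Finset.range i, C ^ l with hS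
  have hS0 : 0 ≤ S := Finset.sum_nonneg fun _ _ => Finset.sum_nonneg fun _ _ => by positivity
  set η := δ / 2 / (S + 1) with hη
  have hη0 : 0 < η := by positivity
  have hηS : η * S ≤ δ / 2 := by
    rw [hη, div_mul_eq_mul_div, div_le_iff₀ (by positivity)]
    have : 0 < δ / 2 := by positivity
    nlinarith
  refine ⟨∑ i ∈ Finset.range J, C * (3 * C + 2 * (k + (k + i : ℕ) + 1)) / η ^ 2,
    Finset.sum_nonneg fun _ _ => by positivity, fun n N hn hN => ?_⟩
  have hn0 : (0 : ℝ) < n := Nat.cast_pos.2 hn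
  have hNC : (N : ℝ) ≤ C * n := by
    rw [div_le_iff₀ hn0] at hN
    refine hN.trans ?_
    gcongr
    have : cPrime k ≤ C := le_max_left _ _
    linarith
  have hsub : ((allocFinset (Fin N) (Fin n) k).filter fun a => (k * loadCount a k : ℝ) < q * N)
      ⊆ (Finset.range J).biUnion fun i => (allocFinset (Fin N) (Fin n) k).filter fun a =>
        η * (Fintype.card (Fin n) : ℝ) ^ 2 < -defect k (k + i) a := by
    intro a ha
    rw [Finset.mem_filter] at ha
    by_contra hcon
    simp only [Finset.mem_biUnion, Finset.mem_range, Finset.mem_filter, not_exists, not_and,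
      not_lt] at hcon
    have hb := balance_of_defect_le (H := Fin N) (V := Fin n) (δ := δ) hη0.le hC0 (by simpa using hn)
      (by simpa using hNC) hδ hηS ha.1 (fun i hi => hcon i hi ha.1) rfl rfl
    simp only [Fintype.card_fin] at hb
    have hle : (k : ℝ) * (loadCount a k / n) ≤ N / n := by
      rw [← mul_div_assoc]
      gcongr
      have := mul_loadCount_le a k
      rw [Fintype.card_fin] at this
      exact_mod_cast this
    have h := hq (N / n) (loadCount a k / n) (by positivity) hN hle hb
    rw [← mul_div_assoc, ← mul_div_assoc, div_le_div_iff_of_pos_right hn0] at h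
    linarith [ha.2]
  calc (((allocFinset (Fin N) (Fin n) k).filter fun a =>
        (k * loadCount a k : ℝ) < q * N).card : ℝ)
      ≤ ∑ i ∈ Finset.range J, (((allocFinset (Fin N) (Fin n) k).filter fun a =>
        η * (Fintype.card (Fin n) : ℝ) ^ 2 < -defect k (k + i) a).card : ℝ) := by
        exact_mod_cast (Finset.card_le_card hsub).trans Finset.card_biUnion_le
    _ ≤ ∑ i ∈ Finset.range J, C * (3 * C + 2 * (k + (k + i : ℕ) + 1)) / η ^ 2
        / n * (allocFinset (Fin N) (Fin n) k).card := by
        refine Finset.sum_le_sum fun i _ => ?_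
        have := card_filter_defect_le (H := Fin N) (V := Fin n) (k := k) (j := k + i) (by omega)
          hη0 (by simpa using hn) (C := C) (by simpa using hNC)
        simpa only [Fintype.card_fin] using this
    _ = _ := by rw [← Finset.sum_mul, ← Finset.sum_div]

/-- If `|H| / |V|` is close to `k` then almost all points are in vertices of load `k`. -/
theorem card_sub_le_mul_loadCount {k : ℕ} {a : H → V} (ha : a ∈ allocFinset H V k) :
    (Fintype.card H : ℝ) - (k + 1) * (Fintype.card H - k * Fintype.card V) ≤ k * loadCount a k := by
  have h1 := mul_loadCount_le a k
  -- The left side is `k (k + 1 - load)`: equal to `k` at load `k` and nonpositive at every larger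
  -- load.
  have h2 : ∀ v, (load a v : ℝ) - (k + 1) * (load a v - k) ≤ if load a v = k then (k : ℝ) else 0 := by
    intro v
    have hv : k ≤ load a v := by
      simp only [allocFinset, Finset.mem_filter, Finset.mem_univ, true_and] at ha; exact ha v
    split_ifs with h
    · rw [h]; simp
    · have : (k : ℝ) + 1 ≤ load a v := by exact_mod_cast (by omega : k + 1 ≤ load a v)
      have hk0 : (0 : ℝ) ≤ k := by positivity
      nlinarith
  have h3 := Finset.sum_le_sum fun v (_ : v ∈ Finset.univ) => h2 v
  rw [← Finset.sum_filter, Finset.sum_const, Finset.sum_sub_distrib, ← Finset.mul_sum,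
    Finset.sum_sub_distrib, Finset.sum_const, ← Nat.cast_sum, sum_load, nsmul_eq_mul,
    nsmul_eq_mul, Finset.card_univ] at h3
  rw [loadCount]
  linarith

end Concentration

/-! ### The process on a random pairing of a fixed allocation -/

section FixedAllocation

theorem card_active_le_hit {H V : Type*} [DecidableEq H] [DecidableEq V] {a : H → V} {k : ℕ}
    (s : Finset H × Finset H) (y : H) : s.1.card ≤ (hit a k s y).1.card + 1 := by
  unfold hit
  split_ifs
  · exact (Finset.card_le_card Finset.subset_union_left).trans (Nat.le_succ _)
  · exact Nat.le_succ _
  · exact Nat.sub_le_iff_le_add.1 Finset.pred_card_le_card_erase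

theorem card_filter_perm_apply_mem {H : Type*} [Fintype H] [DecidableEq H] (p : H) (S : Finset H) :
    Fintype.card H * (Finset.univ.filter fun σ : Equiv.Perm H => σ p ∈ S).card
      = S.card * Fintype.card (Equiv.Perm H) := by
  have key : ∀ x y : H, (Finset.univ.filter fun σ : Equiv.Perm H => σ p = x).card
      = (Finset.univ.filter fun σ : Equiv.Perm H => σ p = y).card := by
    intro x y
    refine Finset.card_bij' (fun σ _ => Equiv.swap x y * σ) (fun σ _ => Equiv.swap x y * σ)
      ?_ ?_ ?_ ?_
    · intro σ hσ
      simp only [Finset.mem_filter, Finset.mem_univ, true_and] at hσ ⊢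
      simp [hσ]
    · intro σ hσ
      simp only [Finset.mem_filter, Finset.mem_univ, true_and] at hσ ⊢
      simp [hσ]
    · intro σ _; simp [← mul_assoc]
    · intro σ _; simp [← mul_assoc]
  have hS : ∀ S : Finset H, (Finset.univ.filter fun σ : Equiv.Perm H => σ p ∈ S).card
      = S.card * (Finset.univ.filter fun σ : Equiv.Perm H => σ p = p).card := by
    intro S
    rw [Finset.card_eq_sum_card_fiberwise (f := fun σ : Equiv.Perm H => σ p) (t := S)
      (by intro σ hσ; simpa using hσ), ← smul_eq_mul, ← Finset.sum_const]
    refine Finset.sum_congr rfl fun x hx => ?_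
    rw [← key x p, Finset.filter_filter]
    congr 1; ext σ
    simp only [Finset.mem_filter, Finset.mem_univ, true_and]
    exact ⟨fun h => h.2, fun h => ⟨h ▸ hx, h⟩⟩
  have hu := hS Finset.univ
  simp only [Finset.mem_univ, Finset.filter_true, Finset.card_univ] at hu
  rw [hS S, hu]; ring

variable {k n m : ℕ}

/-- The state after `t` steps of the deletion process on the multigraph of `a ∘ σ`, started with the
removal of the edge `i`. -/
noncomputable def stateAt (k : ℕ) (a : Fin (2 * m) → Fin n) (i : Fin m)
    (σ : Equiv.Perm (Fin (2 * m))) (t : ℕ) : Finset (Fin (2 * m)) × Finset (Fin (2 * m)) :=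
  (step a k (conjPairing partner σ))^[t] (start a k (σ (firstHalf i)) (σ (secondHalf i)))

theorem le_card_fibre {a : Fin (2 * m) → Fin n} (ha : a ∈ allocFinset (Fin (2 * m)) (Fin n) k)
    (h : Fin (2 * m)) : k ≤ (Finset.univ.filter (a · = a h)).card := by
  simp only [allocFinset, Finset.mem_filter, Finset.mem_univ, true_and] at ha
  exact ha (a h)

theorem W_comp_eq (a : Fin (2 * m) → Fin n) (i : Fin m) (σ : Equiv.Perm (Fin (2 * m))) :
    W k (a ∘ σ, i) = n - (kCore k ((allocGraph (a ∘ σ)).deleteEdges {i})).vertexSet.ncard := by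
  have h : (allocGraph (a ∘ σ)).vertexSet = Set.univ := rfl
  rw [W, lostVertices, h, Set.ncard_univ, Nat.card_eq_fintype_card, Fintype.card_fin]

theorem stateAt_fst_ne_empty_of_le {a : Fin (2 * m) → Fin n} {i : Fin m}
    {σ : Equiv.Perm (Fin (2 * m))} {l t : ℕ} (hlt : l ≤ t) (ht : (stateAt k a i σ t).1 ≠ ∅) :
    (stateAt k a i σ l).1 ≠ ∅ := by
  intro h
  apply ht
  unfold stateAt at h ⊢
  rw [iterate_step_empty_of_le hlt h, h]

/-- Every step consumes an active point, and every lost vertex supplies at most `k - 1` of them. -/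
theorem le_mul_W (hk : 1 ≤ k) {a : Fin (2 * m) → Fin n}
    (ha : a ∈ allocFinset (Fin (2 * m)) (Fin n) k) {i : Fin m} {σ : Equiv.Perm (Fin (2 * m))}
    {t : ℕ} (ht : (stateAt k a i σ t).1 ≠ ∅) : t ≤ (k - 1) * W k (a ∘ σ, i) := by
  have h1 := card_active_iterate_step t (start a k (σ (firstHalf i)) (σ (secondHalf i)))
    (a := a) (k := k) (τ := conjPairing partner σ)
    fun l hl => stateAt_fst_ne_empty_of_le hl.le ht
  have h2 := card_active_hit (a := a) (k := k) (s := (∅, Finset.univ)) (σ (firstHalf i))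
  have h3 := card_active_hit (a := a) (k := k)
    (s := hit a k (∅, Finset.univ) (σ (firstHalf i))) (σ (secondHalf i))
  have h4 := card_vertexSet_kCore_le hk (le_card_fibre ha) σ i t
  have h5 : (Finset.univ.image a).card ≤ n := by
    simpa using Finset.card_le_univ (Finset.univ.image a)
  rw [W_comp_eq]
  set c := (kCore k ((allocGraph (a ∘ σ)).deleteEdges {i})).vertexSet.ncard
  have h6 := Nat.mul_le_mul_left (k - 1) h4
  have h7 := Nat.mul_le_mul_left (k - 1) h5
  rw [Nat.mul_sub]
  simp only [Finset.card_empty, zero_add] at h2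
  unfold start at h1 h6
  omega

/-- Each step loses at most one vertex, and so does each of the two initial hits; at extinction the
survivors lie in the core. -/
theorem W_le {a : Fin (2 * m) → Fin n} (hk : 1 ≤ k)
    (ha : a ∈ allocFinset (Fin (2 * m)) (Fin n) k) {i : Fin m} {σ : Equiv.Perm (Fin (2 * m))}
    {t : ℕ} (ht : (stateAt k a i σ t).1 = ∅) : W k (a ∘ σ, i) ≤ t + 2 := by
  have h1 := card_image_le_iterate_step (a := a) (k := k) (τ := conjPairing partner σ) t
    (start a k (σ (firstHalf i)) (σ (secondHalf i)))
  have h2 := card_image_le_hit (a := a) (k := k) (s := (∅, Finset.univ)) (σ (firstHalf i))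
  have h3 := card_image_le_hit (a := a) (k := k)
    (s := hit a k (∅, Finset.univ) (σ (firstHalf i))) (σ (secondHalf i))
  have h4 := card_image_le_card_vertexSet_kCore (le_card_fibre ha) σ i t ht
  have h5 : (Finset.univ.image a).card = n := by
    rw [Finset.eq_univ_of_forall (s := Finset.univ.image a), Finset.card_univ, Fintype.card_fin]
    intro v
    simp only [allocFinset, Finset.mem_filter, Finset.mem_univ, true_and] at ha
    obtain ⟨h, hh⟩ := Finset.card_pos.1 (lt_of_lt_of_le hk (ha v))
    exact Finset.mem_image.2 ⟨h, Finset.mem_univ _, by simpa using hh⟩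
  rw [W_comp_eq]
  dsimp only at h2
  unfold start at h1 h4
  omega

theorem card_light_univ {a : Fin (2 * m) → Fin n}
    (ha : a ∈ allocFinset (Fin (2 * m)) (Fin n) k) :
    (light a k Finset.univ).card = k * loadCount a k := by
  rw [← card_filter_load_comp, light]
  congr 1; ext h
  simp only [Finset.mem_filter, Finset.mem_univ, true_and]
  exact ⟨fun h' => le_antisymm h' (le_card_fibre ha h), fun h' => h'.le⟩

/-- The main estimate for the deletion process on the random pairing of the points of a fixed
allocation. -/
theorem card_filter_stateAt_le (hk : 3 ≤ k) {z q r η : ℝ} (hz0 : 0 < z) (hz1 : z ≤ 1) (hr0 : 0 < r)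
    (hr1 : r ≤ 1) (hq : 0 ≤ q) (hη : 0 ≤ η) (hr : η + q * z ^ k + (1 - q) * z ≤ r * z ^ 2)
    {a : Fin (2 * m) → Fin n} (ha : a ∈ allocFinset (Fin (2 * m)) (Fin n) k) (i : Fin m) {t j : ℕ}
    (ht : 2 * t + 3 ≤ m) (hlight : q * (2 * m) + k * (t + 2) ≤ k * loadCount a k)
    (hact : (k : ℝ) * (t + 2) ≤ η * m) :
    ((Finset.univ.filter fun σ : Equiv.Perm (Fin (2 * m)) =>
      (stateAt k a i σ t).1 = ∅ ∧ ∀ l < j, (stateAt k a i σ l).1 ≠ ∅).card : ℝ)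
      ≤ r ^ j * (1 - (1 - z) * q) * Fintype.card (Equiv.Perm (Fin (2 * m))) := by
  set s₀ : Equiv.Perm (Fin (2 * m)) → Finset (Fin (2 * m)) × Finset (Fin (2 * m)) :=
    fun σ => start a k (σ (firstHalf i)) (σ (secondHalf i)) with hs₀
  set E : Finset (Equiv.Perm (Fin (2 * m))) := Finset.univ.filter fun σ =>
      (stateAt k a i σ t).1 = ∅ ∧ ∀ l < j, (stateAt k a i σ l).1 ≠ ∅ with hE
  let π : Equiv.Perm (Fin (2 * m)) → Fin (2 * m) × Fin (2 * m) :=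
    fun σ => (σ (firstHalf i), σ (secondHalf i))
  -- Condition on the two points of the removed edge; the pairing of the other points remains
  -- uniform.
  have hfib : ∀ xy : Fin (2 * m) × Fin (2 * m), ((E.filter fun σ => π σ = xy).card : ℝ)
      ≤ ∑ σ ∈ Finset.univ.filter (fun σ => π σ = xy), r ^ j * z ^ (s₀ σ).1.card := by
    rintro ⟨x, y⟩
    set Q : Finset (Equiv.Perm (Fin (2 * m))) := Finset.univ.filter fun σ => π σ = (x, y) with hQ
    by_cases hxy : x = y
    · have : E.filter (fun σ => π σ = (x, y)) = ∅ := by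
        rw [Finset.filter_eq_empty_iff]
        intro σ _ h
        simp only [π, Prod.mk.injEq] at h
        exact firstHalf_ne_secondHalf i i (σ.injective (h.1.trans (hxy.trans h.2.symm)))
      rw [this, Finset.card_empty, Nat.cast_zero]
      exact Finset.sum_nonneg fun _ _ => by positivity
    have hQmem : ∀ σ ∈ Q, σ (firstHalf i) = x ∧ σ (secondHalf i) = y := by
      intro σ hσ; simpa [hQ, π] using hσ
    have hconst : ∑ σ ∈ Q, r ^ j * z ^ (s₀ σ).1.card
        = r ^ j * z ^ (start a k x y).1.card * Q.card := by
      rw [mul_comm _ (Q.card : ℝ), ← nsmul_eq_mul, ← Finset.sum_const]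
      refine Finset.sum_congr rfl fun σ hσ => ?_
      simp only [hs₀]
      rw [(hQmem σ hσ).1, (hQmem σ hσ).2]
    rw [hconst]
    have hsets : E.filter (fun σ => π σ = (x, y)) = Q.filter fun σ =>
        ((step a k (conjPairing partner σ))^[t] (start a k x y)).1 = ∅ ∧
        ∀ l < j, ((step a k (conjPairing partner σ))^[l] (start a k x y)).1 ≠ ∅ := by
      ext σ
      have hst : ∀ h : σ ∈ Q, ∀ l, stateAt k a i σ l
          = (step a k (conjPairing partner σ))^[l] (start a k x y) := by
        intro h l; rw [stateAt, (hQmem σ h).1, (hQmem σ h).2]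
      have hQ' : σ ∈ Q ↔ π σ = (x, y) := by simp [hQ]
      refine Finset.mem_filter.trans (Iff.trans ?_ Finset.mem_filter.symm)
      rw [← hQ', Finset.mem_filter_univ]
      constructor
      · rintro ⟨h1, h2⟩
        simp only [hst h2] at h1
        exact ⟨h2, h1⟩
      · rintro ⟨h2, h1⟩
        simp only [← hst h2] at h1
        exact ⟨h1, h2⟩
    rw [hsets]
    have hU : ((Finset.univ.erase x).erase y).card + 2 = 2 * m := by
      have h1 := Finset.card_erase_add_one (s := Finset.univ.erase x) (a := y)
        (by simp [Ne.symm hxy])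
      have h2 := Finset.card_erase_add_one (Finset.mem_univ x)
      rw [Finset.card_univ, Fintype.card_fin] at h2
      omega
    have hU' : (((Finset.univ.erase x).erase y).card : ℝ) = 2 * m - 2 := by
      have : ((((Finset.univ.erase x).erase y).card + 2 : ℕ) : ℝ) = ((2 * m : ℕ) : ℝ) := by rw [hU]
      push_cast at this; linarith
    -- The `2 m - 2` remaining points lie between `P + 2 t + 1` and `N`. The two initial hits cost
    -- at most `k` light points each and activate at most `2 k` points, whence `t + 2` in the
    -- budgets.
    refine card_filter_dies_le partner_involutive partner_ne hk hz0 hz1 hr0 hr1 hq hη hr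
      (N := 2 * m) (P := m) t j _ _ Q (valid_start (le_card_fibre ha) x y) ?_ ?_ ?_ ?_ ?_ ?_
    · intro u hu v hv σ hσ
      have hσ' := hQmem σ hσ
      simp only [Finset.mem_erase, Finset.mem_univ, and_true] at hu hv
      simp only [hQ, π, Finset.mem_filter, Finset.mem_univ, true_and, Prod.mk.injEq,
        Equiv.Perm.mul_apply, hσ'.1, hσ'.2]
      exact ⟨Equiv.swap_apply_of_ne_of_ne hu.2.symm hv.2.symm,
        Equiv.swap_apply_of_ne_of_ne hu.1.symm hv.1.symm⟩
    · intro σ hσ h hh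
      have hσ' := hQmem σ hσ
      have hinv := conjPairing_involutive partner_involutive σ
      have e1 : conjPairing partner σ x = y := by
        rw [← hσ'.1, ← hσ'.2]; simp [conjPairing, partner_firstHalf]
      have e2 : conjPairing partner σ y = x := by rw [← e1, hinv]
      simp only [Finset.mem_erase, Finset.mem_univ, and_true] at hh ⊢
      exact ⟨fun e => hh.2 (hinv.injective (e.trans e1.symm)),
        fun e => hh.1 (hinv.injective (e.trans e2.symm))⟩
    · rw [hU']; linarith
    · rw [hU']
      have : ((2 * t + 3 : ℕ) : ℝ) ≤ m := by exact_mod_cast ht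
      push_cast at this; linarith
    · have h1 := card_light_le_hit (a := a) (k := k) (s := (∅, Finset.univ)) x
      have h2 := card_light_le_hit (a := a) (k := k) (s := hit a k (∅, Finset.univ) x) y
      dsimp only at h1
      rw [card_light_univ ha] at h1
      have h3 : ((k * loadCount a k : ℕ) : ℝ) ≤ ((light a k (start a k x y).2).card + 2 * k : ℕ) := by
        unfold start; exact_mod_cast (by omega)
      push_cast at h3
      linarith
    · have h1 := card_active_hit (a := a) (k := k) (s := (∅, Finset.univ)) x
      have h2 := card_active_hit (a := a) (k := k) (s := hit a k (∅, Finset.univ) x) y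
      have h3 := card_image_le_hit (a := a) (k := k) (s := (∅, Finset.univ)) x
      have h4 := card_image_le_hit (a := a) (k := k) (s := hit a k (∅, Finset.univ) x) y
      have h5 := Nat.mul_le_mul_left (k - 1) h3
      have h6 := Nat.mul_le_mul_left (k - 1) h4
      rw [Nat.mul_add] at h5 h6
      simp only [Finset.card_empty, zero_add] at h1 h5
      have h7 : ((start a k x y).1.card : ℝ) ≤ ((2 * k : ℕ) : ℝ) := by
        unfold start; exact_mod_cast (by omega)
      push_cast at h7
      linarith
  have hsum : (E.card : ℝ) ≤ ∑ σ, r ^ j * z ^ (s₀ σ).1.card := by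
    have h1 := Finset.card_eq_sum_card_fiberwise (s := E) (t := Finset.univ) (f := π) (by simp)
    rw [h1, ← Finset.sum_fiberwise Finset.univ π, Nat.cast_sum]
    exact Finset.sum_le_sum fun xy _ => hfib xy
  -- If the first point is light, the first hit activates `k - 1 ≥ 2` points and the second removes
  -- at most one, so some point is active at the start.
  have hz : ∀ σ, z ^ (s₀ σ).1.card
      ≤ 1 - if σ (firstHalf i) ∈ light a k Finset.univ then (1 - z) else 0 := by
    intro σ
    split_ifs with h
    · have hv : Valid a k Finset.univ ((∅, Finset.univ) : Finset (Fin (2 * m)) × Finset _) :=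
        ⟨Finset.disjoint_empty_left _, by simp, fun y _ => le_card_fibre ha y⟩
      have h1 := card_hit_of_mem_light hv h
      have h2 := card_active_le_hit (a := a) (k := k)
        (hit a k (∅, Finset.univ) (σ (firstHalf i))) (σ (secondHalf i))
      simp only [Finset.card_empty, zero_add] at h1
      have h3 : 1 ≤ (s₀ σ).1.card := by simp only [hs₀, start]; omega
      calc z ^ (s₀ σ).1.card ≤ z ^ 1 := pow_le_pow_of_le_one hz0.le hz1 h3
        _ = _ := by ring
    · rw [sub_zero]; exact pow_le_one₀ hz0.le hz1
  have hcardlight : q * Fintype.card (Equiv.Perm (Fin (2 * m))) ≤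
      ((Finset.univ.filter fun σ : Equiv.Perm (Fin (2 * m)) =>
        σ (firstHalf i) ∈ light a k Finset.univ).card : ℝ) := by
    have h1 := card_filter_perm_apply_mem (firstHalf i) (light a k Finset.univ)
    rw [card_light_univ ha, Fintype.card_fin] at h1
    have h2 : ((2 * m : ℕ) : ℝ) * ((Finset.univ.filter fun σ : Equiv.Perm (Fin (2 * m)) =>
        σ (firstHalf i) ∈ light a k Finset.univ).card : ℝ)
        = ((k * loadCount a k : ℕ) : ℝ) * Fintype.card (Equiv.Perm (Fin (2 * m))) := by
      exact_mod_cast h1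
    have hm : (0 : ℝ) < ((2 * m : ℕ) : ℝ) := by exact_mod_cast (by omega : 0 < 2 * m)
    refine le_of_mul_le_mul_left ?_ hm
    rw [h2, ← mul_assoc]
    gcongr
    push_cast
    have : (0 : ℝ) ≤ k * (t + 2) := by positivity
    linarith
  refine hsum.trans ?_
  rw [← Finset.mul_sum, mul_assoc]
  gcongr
  refine (Finset.sum_le_sum fun σ _ => hz σ).trans ?_
  rw [Finset.sum_sub_distrib, ← Finset.sum_filter, Finset.sum_const, Finset.sum_const,
    nsmul_eq_mul, nsmul_eq_mul, Finset.card_univ, mul_one]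
  have := mul_le_mul_of_nonneg_right hcardlight (sub_nonneg.2 hz1)
  linarith

end FixedAllocation

/-! ### The joint law and its permutation invariance -/

section Law

variable {k n m : ℕ}

theorem coe_allocFinset : (allocFinset (Fin (2 * m)) (Fin n) k : Set (Fin (2 * m) → Fin n))
    = allocations k n m := by
  ext a
  simp only [allocFinset, allocations, Finset.coe_filter, Finset.mem_univ, true_and,
    Set.mem_ofPred_eq]
  refine forall_congr' fun v => ?_
  rw [load, ← Set.ncard_coe_finset]
  simp [Set.preimage]

theorem law_eq (k n m : ℕ) : law k n m =
    uniformOn ((allocFinset (Fin (2 * m)) (Fin n) k ×ˢ (Finset.univ : Finset (Fin m)) :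
      Finset ((Fin (2 * m) → Fin n) × Fin m)) : Set ((Fin (2 * m) → Fin n) × Fin m)) := by
  rw [law, Finset.coe_product, coe_allocFinset, Finset.coe_univ]

open Classical in
theorem law_real_eq (S : Set ((Fin (2 * m) → Fin n) × Fin m)) :
    (law k n m).real S = ((allocFinset (Fin (2 * m)) (Fin n) k ×ˢ
      (Finset.univ : Finset (Fin m))).filter (· ∈ S)).card
        / ((allocFinset (Fin (2 * m)) (Fin n) k).card * m) := by
  have h : S = ((Finset.univ.filter (· ∈ S) : Finset ((Fin (2 * m) → Fin n) × Fin m)) : Set _) := by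
    simp
  rw [law_eq, Measure.real, h, uniformOn_apply_finset, ENNReal.toReal_div, ENNReal.toReal_natCast,
    ENNReal.toReal_natCast, Finset.card_product, Finset.card_univ, Fintype.card_fin, Nat.cast_mul]
  congr 3
  ext ω
  simp

theorem comp_perm_mem_allocFinset {a : Fin (2 * m) → Fin n} (σ : Equiv.Perm (Fin (2 * m))) :
    a ∘ σ ∈ allocFinset (Fin (2 * m)) (Fin n) k ↔ a ∈ allocFinset (Fin (2 * m)) (Fin n) k := by
  simp only [allocFinset, Finset.mem_filter, Finset.mem_univ, true_and]
  refine forall_congr' fun v => ?_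
  have : load (a ∘ σ) v = load a v := by
    unfold load
    refine Finset.card_bij' (fun h _ => σ h) (fun h _ => σ.symm h) ?_ ?_ ?_ ?_ <;> simp
  rw [this]

open Classical in
/-- The law of the allocation is invariant under permutations of the points. -/
theorem card_filter_mul_card_perm (S : Set ((Fin (2 * m) → Fin n) × Fin m)) :
    ((allocFinset (Fin (2 * m)) (Fin n) k ×ˢ (Finset.univ : Finset (Fin m))).filter (· ∈ S)).card
        * Fintype.card (Equiv.Perm (Fin (2 * m)))
      = ∑ a ∈ allocFinset (Fin (2 * m)) (Fin n) k, ∑ i : Fin m,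
        (Finset.univ.filter fun σ : Equiv.Perm (Fin (2 * m)) => (a ∘ σ, i) ∈ S).card := by
  have h1 : ∀ σ : Equiv.Perm (Fin (2 * m)),
      ((allocFinset (Fin (2 * m)) (Fin n) k ×ˢ (Finset.univ : Finset (Fin m))).filter (· ∈ S)).card
      = ∑ a ∈ allocFinset (Fin (2 * m)) (Fin n) k, ∑ i : Fin m,
        if (a ∘ σ, i) ∈ S then 1 else 0 := by
    intro σ
    rw [Finset.card_filter, Finset.sum_product]
    refine (Finset.sum_bij' (fun a _ => a ∘ σ) (fun a _ => a ∘ σ.symm) ?_ ?_ ?_ ?_ ?_).symm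
    · intro a ha; exact (comp_perm_mem_allocFinset σ).2 ha
    · intro a ha; exact (comp_perm_mem_allocFinset σ.symm).2 ha
    · intro a _; ext h; simp
    · intro a _; ext h; simp
    · intro a _; rfl
  rw [mul_comm, ← Finset.card_univ, ← smul_eq_mul, ← Finset.sum_const,
    Finset.sum_congr rfl fun σ _ => h1 σ, Finset.sum_comm]
  refine Finset.sum_congr rfl fun a _ => ?_
  rw [Finset.sum_comm]
  exact Finset.sum_congr rfl fun i _ => by rw [Finset.card_filter]

-- Reduces a probability to a bound on the permutations of each fixed good allocation, at the cost
-- of the proportion `γ` of bad ones.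
open Classical in
theorem law_real_le {S : Set ((Fin (2 * m) → Fin n) × Fin m)} {β γ : ℝ} (hβ : 0 ≤ β) (hγ : 0 ≤ γ)
    (bad : (Fin (2 * m) → Fin n) → Prop)
    (hbad : (((allocFinset (Fin (2 * m)) (Fin n) k).filter bad).card : ℝ)
      ≤ γ * (allocFinset (Fin (2 * m)) (Fin n) k).card)
    (hgood : ∀ a ∈ allocFinset (Fin (2 * m)) (Fin n) k, ¬ bad a → ∀ i : Fin m,
      ((Finset.univ.filter fun σ : Equiv.Perm (Fin (2 * m)) => (a ∘ σ, i) ∈ S).card : ℝ)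
        ≤ β * Fintype.card (Equiv.Perm (Fin (2 * m)))) :
    (law k n m).real S ≤ β + γ := by
  rw [law_real_eq]
  refine div_le_of_le_mul₀ (by positivity) (by positivity) ?_
  have hP : (0 : ℝ) < Fintype.card (Equiv.Perm (Fin (2 * m))) := Nat.cast_pos.2 Fintype.card_pos
  refine le_of_mul_le_mul_right ?_ hP
  rw [← Nat.cast_mul, card_filter_mul_card_perm, Nat.cast_sum]
  have h1 : ∀ a ∈ allocFinset (Fin (2 * m)) (Fin n) k, ((∑ i : Fin m,
      (Finset.univ.filter fun σ : Equiv.Perm (Fin (2 * m)) => (a ∘ σ, i) ∈ S).card : ℕ) : ℝ)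
      ≤ β * (m * Fintype.card (Equiv.Perm (Fin (2 * m))))
        + if bad a then (m * Fintype.card (Equiv.Perm (Fin (2 * m))) : ℝ) else 0 := by
    intro a ha
    rw [Nat.cast_sum]
    have hconst : ∀ b : ℝ, (m : ℝ) * b = ∑ _i : Fin m, b := by intro b; simp
    split_ifs with hb
    · refine le_add_of_nonneg_of_le (by positivity) ?_
      rw [hconst]
      exact Finset.sum_le_sum fun i _ => by exact_mod_cast Finset.card_le_univ _
    · rw [add_zero, mul_left_comm, hconst]
      exact Finset.sum_le_sum fun i _ => hgood a ha hb i
  refine (Finset.sum_le_sum h1).trans ?_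
  rw [Finset.sum_add_distrib, Finset.sum_const, ← Finset.sum_filter, Finset.sum_const,
    nsmul_eq_mul, nsmul_eq_mul]
  have h2 := mul_le_mul_of_nonneg_right hbad
    (by positivity : (0 : ℝ) ≤ m * Fintype.card (Equiv.Perm (Fin (2 * m))))
  linarith

theorem allocFinset_nonempty (hn : 0 < n) (h : k * n ≤ 2 * m) :
    (allocFinset (Fin (2 * m)) (Fin n) k).Nonempty := by
  -- Allocation by residues: the vertex `v` receives the points `v + l n` for `l < k`.
  refine ⟨fun p => ⟨p % n, Nat.mod_lt _ hn⟩, ?_⟩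
  simp only [allocFinset, Finset.mem_filter, Finset.mem_univ, true_and]
  intro v
  have hlt : ∀ l : Fin k, (v : ℕ) + l * n < 2 * m := by
    intro l
    have h1 : ((l : ℕ) + 1) * n ≤ k * n := Nat.mul_le_mul_right n l.2
    have h2 := v.2
    rw [Nat.add_mul, one_mul] at h1
    omega
  have hcard : (Finset.univ : Finset (Fin k)).card ≤ load (fun p : Fin (2 * m) =>
      (⟨p % n, Nat.mod_lt _ hn⟩ : Fin n)) v := by
    refine Finset.card_le_card_of_injOn (fun l => ⟨(v : ℕ) + l * n, hlt l⟩) ?_ ?_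
    · intro l _
      simp only [Finset.coe_filter, Finset.mem_univ, true_and, Set.mem_ofPred_eq]
      ext
      simp [Nat.mod_eq_of_lt v.2]
    · intro l _ l' _ hl
      simp only [Fin.mk.injEq, add_right_inj] at hl
      exact Fin.ext (Nat.eq_of_mul_eq_mul_right hn hl)
  simpa using hcard

theorem isProbabilityMeasure_law (hn : 0 < n) (hm : 0 < m) (h : k * n ≤ 2 * m) :
    IsProbabilityMeasure (law k n m) := by
  rw [law_eq]
  refine isProbabilityMeasure_uniformOn (Finset.finite_toSet _) ?_
  rw [Finset.coe_nonempty]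
  exact (allocFinset_nonempty hn h).product ⟨⟨0, hm⟩, Finset.mem_univ _⟩

theorem law_real_compl (hn : 0 < n) (hm : 0 < m) (h : k * n ≤ 2 * m)
    (S : Set ((Fin (2 * m) → Fin n) × Fin m)) :
    (law k n m).real Sᶜ = 1 - (law k n m).real S := by
  have := isProbabilityMeasure_law hn hm h
  rw [measureReal_compl (Set.toFinite S).measurableSet, probReal_univ]

end Law

/-! ### Choice of the constants -/

section Parameters

/-- The weights for which the deletion process is a strict supermartingale. -/
theorem exists_weights {k : ℕ} (hk : 3 ≤ k) {q₁ : ℝ} (hq1 : q₁ ≤ 1) (h : 1 < q₁ * (k - 1)) :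
    ∃ q z r η : ℝ, 0 < q ∧ q < q₁ ∧ 0 < z ∧ z < 1 ∧ 0 < r ∧ r < 1 ∧ 0 < η ∧
      η + q * z ^ k + (1 - q) * z ≤ r * z ^ 2 := by
  obtain ⟨K, rfl⟩ : ∃ K, k = K + 1 := ⟨k - 1, by omega⟩
  push_cast at h
  rw [add_sub_cancel_right] at h
  have hK : (2 : ℝ) ≤ K := by exact_mod_cast (by omega : 2 ≤ K)
  have hK0 : (0 : ℝ) < K := by linarith
  -- Any value strictly between `1 / K` and `q₁` would do: supercritical, with slack below `q₁` for
  -- the light points used up.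
  set q := (q₁ + 1 / K) / 2 with hq
  have hqK : q * K = (q₁ * K + 1) / 2 := by rw [hq]; field_simp
  have hq₁ : 1 / (K : ℝ) < q₁ := by rw [div_lt_iff₀ hK0]; exact h
  have hq0 : 0 < q := by
    have : 0 < 1 / (K : ℝ) := by positivity
    rw [hq]; linarith
  have hqlt : q < q₁ := by rw [hq]; linarith
  have hqK1 : 1 < q * K := by linarith
  set s := (q * K - 1) / (2 * K) with hs
  have hs0 : 0 < s := div_pos (by linarith) (by linarith)
  have hKs : K * s = (q * K - 1) / 2 := by rw [hs]; field_simp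
  set z := 1 / (1 + s) with hz
  have hz0 : 0 < z := by positivity
  have hz1 : z < 1 := by rw [hz, div_lt_one (by positivity)]; linarith
  have hzK : z ^ K ≤ 1 / (1 + K * s) := by
    rw [hz, div_pow, one_pow]
    refine one_div_le_one_div_of_le (by positivity) ?_
    exact one_add_mul_le_pow (by linarith) K
  -- The offspring generating function lies below the diagonal just to the left of `1`, its slope `q
  -- K` at `1` being greater than `1`; Bernoulli's inequality makes this explicit.
  have hψ : q * z ^ K + (1 - q) < z := by
    refine (add_le_add_left (mul_le_mul_of_nonneg_left hzK hq0.le) _).trans_lt ?_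
    have h1 : (0 : ℝ) < 1 + K * s := by positivity
    have h2 : 0 < 1 + s := by positivity
    rw [hz, ← sub_pos]
    have e : 1 / (1 + s) - (q * (1 / (1 + K * s)) + (1 - q))
        = s * (q * K - 1 - (1 - q) * (K * s)) / ((1 + s) * (1 + K * s)) := by
      field_simp; ring
    rw [e]
    refine div_pos (mul_pos hs0 ?_) (by positivity)
    rw [hKs]
    nlinarith
  -- `d` is the slack in the supermartingale inequality: half of it allows for active partners
  -- (`η`), the other half gives `r < 1`.
  set d := z * (z - (q * z ^ K + (1 - q))) with hd
  have hd0 : 0 < d := mul_pos hz0 (by linarith)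
  have hrest : 0 < q * z ^ (K + 1) + (1 - q) * z := by
    have : 0 ≤ (1 - q) * z := mul_nonneg (by linarith) hz0.le
    positivity
  refine ⟨q, z, (d / 2 + q * z ^ (K + 1) + (1 - q) * z) / z ^ 2, d / 2, hq0, hqlt, hz0, hz1,
    ?_, ?_, by positivity, ?_⟩
  · refine div_pos ?_ (by positivity)
    linarith
  · rw [div_lt_one (by positivity)]
    have : d = z ^ 2 - q * z ^ (K + 1) - (1 - q) * z := by rw [hd]; ring
    linarith
  · rw [div_mul_cancel₀ _ (by positivity)]

theorem eventually_budget {k : ℕ} (hk : 3 ≤ k) {q q₁ η : ℝ} (hq : q < q₁) (hη : 0 < η) :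
    ∃ κ : ℝ, 0 < κ ∧ ∀ᶠ n : ℕ in atTop, ∀ m t : ℕ, k * n ≤ 2 * m → (t : ℝ) ≤ κ * n →
      2 * t + 3 ≤ m ∧ q * (2 * m) + k * (t + 2) ≤ q₁ * (2 * m) ∧ (k : ℝ) * (t + 2) ≤ η * m := by
  have hk3 : (3 : ℝ) ≤ k := by exact_mod_cast hk
  have hk0 : (0 : ℝ) < k := by linarith
  set d := min (min (q₁ - q) η) 1 with hd
  have hd0 : 0 < d := lt_min (lt_min (by linarith) hη) one_pos
  have hd1 : d ≤ q₁ - q := (min_le_left _ _).trans (min_le_left _ _)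
  have hd2 : d ≤ η := (min_le_left _ _).trans (min_le_right _ _)
  have hd3 : d ≤ 1 := min_le_right _ _
  -- Then `k t ≤ d n / 2`, and `2 k ≤ d n / 2` for large `n`, so `k (t + 2) ≤ d n ≤ d m`, within all
  -- three budgets.
  refine ⟨d / (2 * k), by positivity, ?_⟩
  have hev : ∀ᶠ n : ℕ in atTop, 4 * k / d ≤ (n : ℝ) :=
    tendsto_natCast_atTop_atTop.eventually_ge_atTop _
  filter_upwards [hev] with n hn m t hm ht
  rw [div_le_iff₀ hd0] at hn
  have hm' : (k : ℝ) * n ≤ 2 * m := by exact_mod_cast hm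
  have hn0 : (0 : ℝ) ≤ n := by positivity
  have hnm : (n : ℝ) ≤ m := by nlinarith
  have hkt : (k : ℝ) * (t + 2) ≤ d * n := by
    have : (k : ℝ) * t ≤ k * (d / (2 * k) * n) := by gcongr
    have e : (k : ℝ) * (d / (2 * k) * n) = d * n / 2 := by field_simp
    linarith
  have hdm : d * n ≤ d * m := by gcongr
  have hm0 : (0 : ℝ) ≤ m := by positivity
  refine ⟨?_, ?_, ?_⟩
  · have h1 : d * (m : ℝ) ≤ m := by nlinarith
    have h2 : (3 : ℝ) * (t + 2) ≤ k * (t + 2) := by gcongr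
    have h3 : ((2 * t + 3 : ℕ) : ℝ) ≤ m := by
      push_cast
      have : (0 : ℝ) ≤ t := by positivity
      linarith
    exact_mod_cast h3
  · have : d * (m : ℝ) ≤ (q₁ - q) * m := by gcongr
    nlinarith
  · have : d * (m : ℝ) ≤ η * m := by gcongr
    linarith

theorem exists_dies_le {k : ℕ} (hk : 3 ≤ k) {z q q₁ r η : ℝ} (hz0 : 0 < z) (hz1 : z ≤ 1)
    (hr0 : 0 < r) (hr1 : r ≤ 1) (hq : 0 ≤ q) (hqq : q < q₁) (hη : 0 < η)
    (hr : η + q * z ^ k + (1 - q) * z ≤ r * z ^ 2) :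
    ∃ κ : ℝ, 0 < κ ∧ ∀ᶠ n : ℕ in atTop, ∀ m t j : ℕ, k * n ≤ 2 * m → (t : ℝ) ≤ κ * n →
      ∀ a ∈ allocFinset (Fin (2 * m)) (Fin n) k, q₁ * (2 * m) ≤ k * loadCount a k → ∀ i : Fin m,
      ((Finset.univ.filter fun σ : Equiv.Perm (Fin (2 * m)) =>
        (stateAt k a i σ t).1 = ∅ ∧ ∀ l < j, (stateAt k a i σ l).1 ≠ ∅).card : ℝ)
        ≤ r ^ j * (1 - (1 - z) * q) * Fintype.card (Equiv.Perm (Fin (2 * m))) := by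
  obtain ⟨κ, hκ, hev⟩ := eventually_budget hk hqq hη
  refine ⟨κ, hκ, ?_⟩
  filter_upwards [hev] with n hn m t j hm ht a ha hlight i
  obtain ⟨h1, h2, h3⟩ := hn m t hm ht
  exact card_filter_stateAt_le hk hz0 hz1 hr0 hr1 hq hη.le hr ha i h1 (h2.trans hlight) h3

end Parameters

/-! ### The dichotomy below `c'_k` and the case `c → k` -/

section Main

variable {k : ℕ}

theorem stateAt_fst_eq_empty_of_W_lt (hk : 3 ≤ k) {n m : ℕ} {a : Fin (2 * m) → Fin n}
    (ha : a ∈ allocFinset (Fin (2 * m)) (Fin n) k) {i : Fin m} {σ : Equiv.Perm (Fin (2 * m))}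
    {t : ℕ} {x : ℝ} (hW : (W k (a ∘ σ, i) : ℝ) < x) (ht : k * x ≤ t) :
    (stateAt k a i σ t).1 = ∅ := by
  by_contra hne
  have h1 := le_mul_W (by omega) ha hne
  have h2 : (k - 1) * W k (a ∘ σ, i) ≤ k * W k (a ∘ σ, i) := Nat.mul_le_mul_right _ (Nat.sub_le k 1)
  have h3 : (t : ℝ) ≤ k * W k (a ∘ σ, i) := by exact_mod_cast h1.trans h2
  have hk0 : (0 : ℝ) < k := by exact_mod_cast (by omega : 0 < k)
  have h4 : (k : ℝ) * W k (a ∘ σ, i) < k * x := by gcongr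
  linarith

/-- Explains `ε' = κ / (2 k)`: a process alive after `⌊κ n⌋` steps has lost at least `κ n / (2 k)`
vertices. -/
theorem eventually_floor_budget {κ : ℝ} (hκ : 0 < κ) (hk : 3 ≤ k) :
    ∀ᶠ n : ℕ in atTop, k * (κ / (2 * k) * n) ≤ (⌊κ * n⌋₊ : ℝ) ∧ (⌊κ * n⌋₊ : ℝ) ≤ κ * n := by
  have hk0 : (0 : ℝ) < k := by exact_mod_cast (by omega : 0 < k)
  have hev : ∀ᶠ n : ℕ in atTop, 2 / κ ≤ (n : ℝ) :=
    tendsto_natCast_atTop_atTop.eventually_ge_atTop _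
  filter_upwards [hev] with n hn
  rw [div_le_iff₀ hκ] at hn
  refine ⟨?_, Nat.floor_le (by positivity)⟩
  have h1 := Nat.lt_floor_add_one (κ * n)
  have e : (k : ℝ) * (κ / (2 * k) * n) = κ * n / 2 := by field_simp
  linarith

theorem eventually_sizes (hk : 3 ≤ k) {m : ℕ → ℕ}
    (hm : ∀ᶠ n in atTop, (k : ℝ) ≤ avgDegree n (m n)) :
    ∀ᶠ n in atTop, 0 < n ∧ 0 < m n ∧ k * n ≤ 2 * m n := by
  filter_upwards [hm, eventually_gt_atTop 0] with n hn hn0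
  have hn0' : (0 : ℝ) < n := Nat.cast_pos.2 hn0
  rw [avgDegree, le_div_iff₀ hn0'] at hn
  have h : k * n ≤ 2 * m n := by exact_mod_cast hn
  refine ⟨hn0, ?_, h⟩
  have : 0 < k * n := Nat.mul_pos (by omega) hn0
  omega

theorem W_dichotomy (hk : 3 ≤ k) {ε : ℝ} (hε : 0 < ε) :
    ∃ ε' : ℝ, 0 < ε' ∧ ∀ m : ℕ → ℕ,
      (∀ᶠ n in atTop, (k : ℝ) ≤ avgDegree n (m n) ∧ avgDegree n (m n) ≤ cPrime k - ε) →
      (∀ h : ℕ → ℝ, Tendsto h atTop atTop →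
        Tendsto (fun n : ℕ => (law k n (m n)).real
          {ω | (W k ω : ℝ) ≤ h n ∨ ε' * (n : ℝ) ≤ (W k ω : ℝ)}) atTop (𝓝 1)) ∧
      (∃ δ : ℝ, 0 < δ ∧ ∀ᶠ n : ℕ in atTop,
        δ ≤ (law k n (m n)).real {ω | ε' * (n : ℝ) ≤ (W k ω : ℝ)}) := by
  classical
  obtain ⟨q₁, hq0, hq1, hqk, D, hD0, hD⟩ := exists_card_filter_light_lt hk hε
  obtain ⟨q, z, r, η, hq, hqq, hz0, hz1, hr0, hr1, hη, hr⟩ := exists_weights hk hq1 hqk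
  obtain ⟨κ, hκ, hκev⟩ := exists_dies_le hk hz0 hz1.le hr0 hr1.le hq.le hqq hη hr
  have hk0 : (0 : ℝ) < k := by exact_mod_cast (by omega : 0 < k)
  have hzq : 0 < (1 - z) * q := mul_pos (by linarith) hq
  have hzq1 : (1 - z) * q ≤ 1 := by nlinarith
  refine ⟨κ / (2 * k), by positivity, fun m hm => ?_⟩
  set ε' := κ / (2 * k) with hε'
  have hbound : ∀ᶠ n : ℕ in atTop, ∀ (j : ℕ) (S : Set ((Fin (2 * m n) → Fin n) × Fin (m n))),
      (∀ a ∈ allocFinset (Fin (2 * m n)) (Fin n) k, ∀ (i : Fin (m n))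
        (σ : Equiv.Perm (Fin (2 * m n))), (a ∘ σ, i) ∈ S →
        (W k (a ∘ σ, i) : ℝ) < ε' * n ∧ ∀ l < j, (stateAt k a i σ l).1 ≠ ∅) →
      (law k n (m n)).real S ≤ r ^ j * (1 - (1 - z) * q) + D / n := by
    filter_upwards [hκev, eventually_floor_budget hκ hk, eventually_sizes hk (hm.mono fun _ h => h.1),
      hm] with n h1 ht hsz hav j S hS
    refine law_real_le (mul_nonneg (by positivity) (by linarith)) (by positivity)
      (fun a => (k * loadCount a k : ℝ) < q₁ * (2 * m n : ℕ)) ?_ ?_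
    · refine hD n (2 * m n) hsz.1 ?_
      have := hav.2
      rw [avgDegree] at this
      push_cast
      exact this
    · intro a ha hgood i
      refine le_trans ?_ (h1 (m n) ⌊κ * n⌋₊ j hsz.2.2 ht.2 a ha (by push_cast at hgood; linarith) i)
      refine Nat.cast_le.2 (Finset.card_le_card fun σ hσ => ?_)
      rw [Finset.mem_filter] at hσ ⊢
      obtain ⟨hW, hl⟩ := hS a ha i σ hσ.2
      exact ⟨hσ.1, stateAt_fst_eq_empty_of_W_lt hk ha hW ht.1, hl⟩
  have hDn : Tendsto (fun n : ℕ => D / (n : ℝ)) atTop (𝓝 0) :=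
    tendsto_const_div_atTop_nhds_zero_nat D
  refine ⟨fun h hh => ?_, (1 - z) * q / 2, by positivity, ?_⟩
  -- Extinction at a time `l < ⌊h n⌋ - 1` gives `W ≤ l + 2 ≤ ⌊h n⌋`, so an intermediate `W` forces
  -- survival for `⌊h n⌋ - 1` steps.
  · have hj : Tendsto (fun n => ⌊h n⌋₊ - 1) atTop atTop :=
      (tendsto_sub_atTop_nat 1).comp (tendsto_nat_floor_atTop.comp hh)
    have hlim : Tendsto (fun n : ℕ => 1 - (r ^ (⌊h n⌋₊ - 1) + D / (n : ℝ))) atTop (𝓝 1) := by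
      have h1 := (tendsto_pow_atTop_nhds_zero_of_lt_one hr0.le hr1).comp hj
      simpa using (h1.add hDn).const_sub 1
    refine tendsto_of_tendsto_of_tendsto_of_le_of_le' hlim tendsto_const_nhds ?_ ?_
    · filter_upwards [hbound, eventually_sizes hk (hm.mono fun _ h => h.1),
        hh.eventually_ge_atTop 1] with n h1 hsz hh1
      have hc := law_real_compl hsz.1 hsz.2.1 hsz.2.2
        {ω | (W k ω : ℝ) ≤ h n ∨ ε' * (n : ℝ) ≤ (W k ω : ℝ)}
      have h2 := h1 (⌊h n⌋₊ - 1) {ω | (W k ω : ℝ) ≤ h n ∨ ε' * (n : ℝ) ≤ (W k ω : ℝ)}ᶜ (by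
        intro a ha i σ hS
        simp only [Set.mem_compl_iff, Set.mem_ofPred_eq, not_or, not_le] at hS
        refine ⟨hS.2, fun l hl he => ?_⟩
        have h3 := W_le (by omega) ha he
        have h4 : W k (a ∘ σ, i) ≤ ⌊h n⌋₊ := by omega
        have h5 : (W k (a ∘ σ, i) : ℝ) ≤ h n :=
          (Nat.cast_le.2 h4).trans (Nat.floor_le (by linarith))
        linarith [hS.1])
      have h3 : r ^ (⌊h n⌋₊ - 1) * (1 - (1 - z) * q) ≤ r ^ (⌊h n⌋₊ - 1) :=
        mul_le_of_le_one_right (by positivity) (by linarith)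
      linarith
    · filter_upwards [eventually_sizes hk (hm.mono fun _ h => h.1)] with n hsz
      have := isProbabilityMeasure_law hsz.1 hsz.2.1 hsz.2.2
      exact measureReal_le_one
  · filter_upwards [hbound, eventually_sizes hk (hm.mono fun _ h => h.1),
      hDn.eventually_le_const (show (0 : ℝ) < (1 - z) * q / 2 by positivity)] with n h1 hsz hDle
    have hc := law_real_compl hsz.1 hsz.2.1 hsz.2.2 {ω | ε' * (n : ℝ) ≤ (W k ω : ℝ)}
    have h2 := h1 0 {ω | ε' * (n : ℝ) ≤ (W k ω : ℝ)}ᶜ (by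
      intro a ha i σ hS
      simp only [Set.mem_compl_iff, Set.mem_ofPred_eq, not_le] at hS
      exact ⟨hS, fun l hl => absurd hl (by omega)⟩)
    rw [pow_zero, one_mul] at h2
    linarith

theorem W_near_k (hk : 3 ≤ k) :
    ∃ ε' : ℝ, 0 < ε' ∧ ∀ m : ℕ → ℕ,
      (∀ᶠ n in atTop, (k : ℝ) ≤ avgDegree n (m n)) →
      Tendsto (fun n : ℕ => avgDegree n (m n)) atTop (𝓝 (k : ℝ)) →
      Tendsto (fun n : ℕ => (law k n (m n)).real {ω | ε' * (n : ℝ) ≤ (W k ω : ℝ)})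
        atTop (𝓝 1) := by
  classical
  have hk3 : (3 : ℝ) ≤ k := by exact_mod_cast hk
  -- The proportion `3 / 4` is supercritical for every `k ≥ 3`, as `3 / 4 * 2 > 1`.
  obtain ⟨q, z, r, η, hq, hqq, hz0, hz1, hr0, hr1, hη, hr⟩ :=
    exists_weights (q₁ := 3 / 4) hk (by norm_num) (by linarith)
  obtain ⟨κ, hκ, hκev⟩ := exists_dies_le hk hz0 hz1.le hr0 hr1.le hq.le hqq hη hr
  have hzq : 0 < (1 - z) * q := mul_pos (by linarith) hq
  have hzq1 : (1 - z) * q ≤ 1 := by nlinarith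
  refine ⟨κ / (2 * k), by positivity, fun m hm hlim => ?_⟩
  set ε' := κ / (2 * k) with hε'
  have hlight : ∀ p : ℝ, p < 1 → ∀ᶠ n : ℕ in atTop, ∀ a ∈ allocFinset (Fin (2 * m n)) (Fin n) k,
      p * (2 * m n) ≤ k * loadCount a k := by
    intro p hp
    have h1 : Tendsto (fun n : ℕ => (1 - p) * avgDegree n (m n)
        - (k + 1) * (avgDegree n (m n) - k)) atTop (𝓝 ((1 - p) * k - (k + 1) * (k - k))) :=
      (hlim.const_mul _).sub ((hlim.sub_const _).const_mul _)
    have h2 : (0 : ℝ) < (1 - p) * k - (k + 1) * (k - k) := by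
      rw [sub_self, mul_zero, sub_zero]; exact mul_pos (by linarith) (by linarith)
    filter_upwards [h1.eventually_const_lt h2, eventually_gt_atTop 0] with n hn hn0 a ha
    have h3 := card_sub_le_mul_loadCount ha
    simp only [Fintype.card_fin] at h3
    have hn0' : (0 : ℝ) < n := Nat.cast_pos.2 hn0
    have h4 : avgDegree n (m n) * n = 2 * m n := by rw [avgDegree]; field_simp
    have h5 := mul_pos hn hn0'
    have h6 : ((1 - p) * avgDegree n (m n) - (k + 1) * (avgDegree n (m n) - k)) * n
        = (1 - p) * (avgDegree n (m n) * n) - (k + 1) * (avgDegree n (m n) * n - k * n) := by ring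
    rw [h6, h4] at h5
    push_cast at h3
    linarith
  have hsmall : ∀ δ : ℝ, 0 < δ → ∀ᶠ n : ℕ in atTop,
      (law k n (m n)).real {ω | ε' * (n : ℝ) ≤ (W k ω : ℝ)}ᶜ ≤ δ := by
    intro δ hδ
    obtain ⟨j, hj⟩ := exists_pow_lt_of_lt_one (half_pos hδ) hr1
    -- Weight for the first `j` steps, with `r = 1` and almost all points light: dying there has
    -- probability at most `1 - (1 - y) (1 - y / 4) ≤ 5 y / 4 < δ / 2`. Dying later, but within `κ
    -- n` steps, has probability at most `r ^ j < δ / 2`.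
    set y := min (1 / 4) (δ / 4) with hy
    have hy0 : 0 < y := lt_min (by norm_num) (by positivity)
    have hy1 : y ≤ 1 / 4 := min_le_left _ _
    have hy2 : y ≤ δ / 4 := min_le_right _ _
    have hyw : y ^ 2 / 4 + (1 - y / 4) * y ^ k + (1 - (1 - y / 4)) * y ≤ 1 * y ^ 2 := by
      have h1 : y ^ k ≤ y ^ 3 := pow_le_pow_of_le_one hy0.le (by linarith) hk
      have h2 : y ^ 3 ≤ 1 / 4 * y ^ 2 := by
        rw [pow_succ' y 2]; gcongr
      have h3 : (1 - y / 4) * y ^ k ≤ y ^ k :=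
        mul_le_of_le_one_left (by positivity) (by linarith)
      nlinarith
    obtain ⟨κ', hκ', hκev'⟩ := exists_dies_le (q₁ := 1 - y / 8) hk hy0 (by linarith) one_pos le_rfl
      (show 0 ≤ 1 - y / 4 by linarith) (by linarith) (show 0 < y ^ 2 / 4 by positivity) hyw
    have hjev : ∀ᶠ n : ℕ in atTop, j / κ' ≤ (n : ℝ) :=
      tendsto_natCast_atTop_atTop.eventually_ge_atTop _
    filter_upwards [hκev, hκev', eventually_floor_budget hκ hk, eventually_sizes hk hm,
      hlight (3 / 4) (by norm_num), hlight (1 - y / 8) (by linarith), hjev]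
      with n h1 h2 ht hsz hl1 hl2 hjn
    rw [div_le_iff₀ hκ'] at hjn
    have h3 := law_real_le (k := k) (n := n) (m := m n)
      (S := {ω | ε' * (n : ℝ) ≤ (W k ω : ℝ)}ᶜ) hδ.le le_rfl (fun _ => False) (by simp) (by
        intro a ha _ i
        have b1 := h1 (m n) ⌊κ * n⌋₊ j hsz.2.2 ht.2 a ha (hl1 a ha) i
        have b2 := h2 (m n) j 0 hsz.2.2 (by linarith) a ha (hl2 a ha) i
        set P : ℝ := (Fintype.card (Equiv.Perm (Fin (2 * m n))) : ℝ) with hP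
        have hP0 : 0 ≤ P := by positivity
        refine le_trans ?_ ((add_le_add b1 b2).trans ?_)
        · refine (Nat.cast_le.2 ((Finset.card_le_card fun σ hσ => ?_).trans
            (Finset.card_union_le _ _))).trans (Nat.cast_add _ _).le
          have hS : (W k (a ∘ σ, i) : ℝ) < ε' * n := by simpa using hσ
          rw [Finset.mem_union, Finset.mem_filter_univ, Finset.mem_filter_univ]
          by_cases he : (stateAt k a i σ j).1 = ∅
          · exact Or.inr ⟨he, fun l hl => absurd hl (by omega)⟩
          · exact Or.inl ⟨stateAt_fst_eq_empty_of_W_lt hk ha hS ht.1,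
              fun l hl => stateAt_fst_ne_empty_of_le hl.le he⟩
        rw [← add_mul]
        refine mul_le_mul_of_nonneg_right ?_ hP0
        have c1 : r ^ j * (1 - (1 - z) * q) ≤ r ^ j :=
          mul_le_of_le_one_right (by positivity) (by linarith)
        rw [one_pow, one_mul]
        nlinarith)
    linarith
  have h0 : Tendsto (fun n : ℕ => (law k n (m n)).real {ω | ε' * (n : ℝ) ≤ (W k ω : ℝ)}ᶜ)
      atTop (𝓝 0) := by
    rw [Metric.tendsto_nhds]
    intro δ hδ
    filter_upwards [hsmall (δ / 2) (by positivity)] with n hn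
    rw [Real.dist_eq, sub_zero, abs_of_nonneg measureReal_nonneg]
    linarith
  have h1 := h0.const_sub 1
  rw [sub_zero] at h1
  refine h1.congr' ?_
  filter_upwards [eventually_sizes hk hm] with n hsz
  rw [law_real_compl hsz.1 hsz.2.1 hsz.2.2]
  ring

end Main

end CoreRobust

theorem mainTheorem6 (k : ℕ) (hk : 3 ≤ k) :
    (∀ ε : ℝ, 0 < ε → ∃ ε' : ℝ, 0 < ε' ∧ ∀ m : ℕ → ℕ,
      (∀ᶠ n in atTop, (k : ℝ) ≤ CoreRobust.avgDegree n (m n) ∧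
        CoreRobust.avgDegree n (m n) ≤ CoreRobust.cPrime k - ε) →
      (∀ h : ℕ → ℝ, Tendsto h atTop atTop →
        Tendsto (fun n : ℕ => (CoreRobust.law k n (m n)).real
          {ω | (CoreRobust.W k ω : ℝ) ≤ h n ∨ ε' * (n : ℝ) ≤ (CoreRobust.W k ω : ℝ)})
          atTop (𝓝 1)) ∧
      (∃ δ : ℝ, 0 < δ ∧ ∀ᶠ n : ℕ in atTop,
        δ ≤ (CoreRobust.law k n (m n)).real {ω | ε' * (n : ℝ) ≤ (CoreRobust.W k ω : ℝ)})) ∧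
    (∃ ε' : ℝ, 0 < ε' ∧ ∀ m : ℕ → ℕ,
      (∀ᶠ n in atTop, (k : ℝ) ≤ CoreRobust.avgDegree n (m n)) →
      Tendsto (fun n : ℕ => CoreRobust.avgDegree n (m n)) atTop (𝓝 (k : ℝ)) →
      Tendsto (fun n : ℕ => (CoreRobust.law k n (m n)).real
        {ω | ε' * (n : ℝ) ≤ (CoreRobust.W k ω : ℝ)}) atTop (𝓝 1)) :=
  ⟨fun _ hε => CoreRobust.W_dichotomy hk hε, CoreRobust.W_near_k hk⟩
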